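/- **Setting.** Let $N\ge 1$, $s\in(0,1)$, $m>0$, $\kappa>0$, and let $\Omega\subset\mathbb R^N$ be a bounded convex polyhedral domain (the nonempty interior of a convex polytope). Write $$|v|_{s}^2=\int_{\mathbb R^N}\int_{\mathbb R^N}\frac{(v(x)-v(z))^2}{|x-z|^{N+2s}}\,dz\,dx,\qquad a(v,\chi)=\int_{\mathbb R^N}\int_{\mathbb R^N}\frac{(v(x)-v(z))(\chi(x)-\chi(z))}{|x-z|^{N+2s}}\,dz\,dx,$$ $$\|v_2\|_{(v_1,p)}^2=\int_\Omega(|v_1|+|v_2|)^{p-2}|v_2|^2\,dx,\qquad \psi(y)=|y|^{\frac{1-m}{m}}y,\qquad \psi^{-1}(y)=|y|^{m-1}y .$$ *Continuous problem.* Let $T>0$, $u_0\in L^\infty(\mathbb R^N)$ with $u_0=0$ outside $\Omega$, and let $u$ be a weak solution of $u_t=-(-\Delta)^s(|u|^{m-1}u)$ in $\Omega\times(0,T]$, $u=0$ outside $\Omega$, $u(\cdot,0)=u_0$. This means: $u$ is measurable, $u(\cdot,t)=0$ outside $\Omega$ for all $t\in[0,T]$, $u\in C([0,T];L^1(\mathbb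 R^N))$, $w:=|u|^{m-1}u\in L^2(0,T;H^s(\mathbb R^N))$, and $$-\int_0^T\!\!\int_{\mathbb R^N}u\,\varphi_t\,dx\,dt+\int_0^Ta(w(t),\varphi(t))\,dt=\int_{\mathbb R^N}u_0\,\varphi(\cdot,0)\,dx$$ for all $\varphi$ that are Lipschitz in $(x,t)$, vanish outside $\Omega$, and satisfy $\varphi(\cdot,T)=0$. *Discrete problem.* Let $T_h$ be a finite conforming triangulation of $\overline\Omega$ into closed $N$-simplices (two simplices that meet do so in a common face) with $|K|\ge\kappa(\operatorname{diam}K)^N$ for all $K\in T_h$. Let $S_h$ be the space of continuous functions on $\mathbb R^N$ that are affine on every $K\in T_h$ and vanish outside $\Omega$; let $\Pi_hv\in S_h$ be the piecewise linear interpolant of $v$ (equal to $v$ at the vertices in $\Omega$), and let $P_hv\in S_h$ be the $H^s$-projection of $v\in H^s(\mathbb R^N)$, given by $a(v-P_hv,\chi)=0$ for all $\chi\in S_h$. Let $\tau>0$ and $M\in\mathbb N$ with $M\tau=T$; put $t_n=n\tau$, $I_n=(t_{n-1},t_n)$, $w_n=w(\cdot,t_n)$, $\bar w^n=\tau^{-1}\int_{I_n}w(\cdot,t)\,dt$.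 Let $W_0=\psi^{-1}(\Pi_h\psi(w_0))$ and let $W_1,\dots,W_M\in S_h$ satisfy $$\int_{\mathbb R^N}\frac{\psi(W_n)-\psi(W_{n-1})}{\tau}\,\chi\,dx+a(W_n,\chi)=0\qquad\text{for all }\chi\in S_h,\ 1\le n\le M .$$ Let $W(\cdot,0)=W_0$ and $W(\cdot,t)=W_n$ for $t\in(t_{n-1},t_n]$. **Theorem.** There is a constant $c>0$ that depends only on $N,\Omega,s,m,\kappa$ (in particular, it is independent of $h$ and $\tau$, that is, of the triangulation and of the time step) such that, for all data as above, $$\begin{aligned} &\int_0^T\|w-W\|_{(w,\frac{m+1}{m})}^2\,dt+\Big|\int_0^Tw\,dt-\int_0^TW\,dt\Big|_{s}^2\\ &\quad\le c\Big(\sum_{n=1}^M\int_{I_n}\|w_n-w\|_{(w,\frac{m+1}{m})}^2\,dt+\int_0^T\|w-P_hw\|_{(w,\frac{m+1}{m})}^2\,dt+\|\psi(w_0)-\Pi_h\psi(w_0)\|_{L^2}^2\\ &\qquad\quad+\Big|\tau\sum_{n=1}^M(\bar w^n-P_h\bar w^n)\Big|_{s}^2\Big). \end{aligned}$$ Both sides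 are understood in $[0,\infty]$; in particular, the left side is finite if the right side is. -/

import Mathlib

open MeasureTheory Set Filter Topology
open scoped ENNReal NNReal

noncomputable section

namespace FracDiffusion

/-! ### Nonlinearities -/

/-- `y ↦ |y|^(m-1) y`, so that `w = spow m u`. For `m > 0` this is the inverse of `psi m`. -/
def spow (m y : ℝ) : ℝ := |y| ^ (m - 1) * y

/-- `ψ(y) = |y|^((1-m)/m) y`. -/
def psi (m y : ℝ) : ℝ := |y| ^ ((1 - m) / m) * y

/-- `spow m` is a right inverse of `ψ`. -/
theorem psi_spow {m : ℝ} (hm : 0 < m) (y : ℝ) : psi m (spow m y) = y := by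
  rcases eq_or_ne y 0 with rfl | hy
  · simp [psi, spow]
  · have hy' : 0 < |y| := abs_pos.mpr hy
    have h1 : |spow m y| = |y| ^ m := by
      unfold spow
      rw [abs_mul, abs_of_nonneg (Real.rpow_nonneg (abs_nonneg y) _)]
      conv_lhs => rw [← Real.rpow_one |y|, ← Real.rpow_mul hy'.le, ← Real.rpow_add hy']
      congr 1; ring
    unfold psi
    rw [h1]
    unfold spow
    rw [← mul_assoc, ← Real.rpow_mul hy'.le, ← Real.rpow_add hy']
    have : m * ((1 - m) / m) + (m - 1) = 0 := by field_simp; ring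
    rw [this, Real.rpow_zero, one_mul]

/-- `spow m` is a left inverse of `ψ`. -/
theorem spow_psi {m : ℝ} (hm : 0 < m) (y : ℝ) : spow m (psi m y) = y := by
  rcases eq_or_ne y 0 with rfl | hy
  · simp [psi, spow]
  · have hy' : 0 < |y| := abs_pos.mpr hy
    have h1 : |psi m y| = |y| ^ (1 / m) := by
      unfold psi
      rw [abs_mul, abs_of_nonneg (Real.rpow_nonneg (abs_nonneg y) _)]
      conv_lhs => rw [← Real.rpow_one |y|, ← Real.rpow_mul hy'.le, ← Real.rpow_add hy']
      congr 1; field_simp; ring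
    unfold spow
    rw [h1]
    unfold psi
    rw [← mul_assoc, ← Real.rpow_mul hy'.le, ← Real.rpow_add hy']
    have : 1 / m * (m - 1) + (1 - m) / m = 0 := by field_simp; ring
    rw [this, Real.rpow_zero, one_mul]

variable {N : ℕ}

/-! ### The space `H^s` and the quasi-norm -/

/-- The squared Gagliardo seminorm `∬ (v(x)-v(z))² / |x-z|^(N+2s) dz dx`, with values
in `[0,∞]`. -/
def hsSeminormSq (s : ℝ) (v : EuclideanSpace ℝ (Fin N) → ℝ) : ℝ≥0∞ :=
  ∫⁻ q : EuclideanSpace ℝ (Fin N) × EuclideanSpace ℝ (Fin N),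
    ENNReal.ofReal ((v q.1 - v q.2) ^ 2 / ‖q.1 - q.2‖ ^ ((N : ℝ) + 2 * s))

/-- The bilinear form `∬ (v(x)-v(z)) (χ(x)-χ(z)) / |x-z|^(N+2s) dz dx`. -/
def hsForm (s : ℝ) (v χ : EuclideanSpace ℝ (Fin N) → ℝ) : ℝ :=
  ∫ q : EuclideanSpace ℝ (Fin N) × EuclideanSpace ℝ (Fin N),
    (v q.1 - v q.2) * (χ q.1 - χ q.2) / ‖q.1 - q.2‖ ^ ((N : ℝ) + 2 * s)

/-- The squared quasi-norm `‖v₂‖²_{(v₁,p)} = ∫_Ω (|v₁|+|v₂|)^(p-2) |v₂|²`, with values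
in `[0,∞]`. -/
def quasiNormSq (Ω : Set (EuclideanSpace ℝ (Fin N))) (p : ℝ)
    (v₁ v₂ : EuclideanSpace ℝ (Fin N) → ℝ) : ℝ≥0∞ :=
  ∫⁻ x in Ω, ENNReal.ofReal ((|v₁ x| + |v₂ x|) ^ (p - 2) * |v₂ x| ^ 2)

/-! ### The domain and its triangulations -/

/-- A bounded convex polyhedral domain: a nonempty interior of a convex polytope. -/
def IsConvexPolyhedralDomain (Ω : Set (EuclideanSpace ℝ (Fin N))) : Prop :=
  Ω.Nonempty ∧ ∃ F : Finset (EuclideanSpace ℝ (Fin N)), Ω = interior (convexHull ℝ (F : Set _))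

/-- The `N`-simplices of a simplicial complex, each given by its `N + 1` vertices. -/
def cells (𝒯 : Geometry.SimplicialComplex ℝ (EuclideanSpace ℝ (Fin N))) :
    Set (Finset (EuclideanSpace ℝ (Fin N))) :=
  {K | K ∈ 𝒯.faces ∧ K.card = N + 1}

/-- A regular (conforming and `κ`-shape-regular) triangulation of `Ω`: finitely many simplices
that meet in common faces, fill the closure of `Ω`, and satisfy `|K| ≥ κ (diam K)^N`. -/
structure IsTriangulation (Ω : Set (EuclideanSpace ℝ (Fin N))) (κ : ℝ)
    (𝒯 : Geometry.SimplicialComplex ℝ (EuclideanSpace ℝ (Fin N))) : Prop where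
  finite : 𝒯.faces.Finite
  pure : ∀ f ∈ 𝒯.faces, ∃ K ∈ cells 𝒯, f ⊆ K
  space_eq : 𝒯.space = closure Ω
  shape_regular : ∀ K ∈ cells 𝒯,
    κ * Metric.diam (convexHull ℝ (K : Set (EuclideanSpace ℝ (Fin N)))) ^ N ≤
      volume.real (convexHull ℝ (K : Set (EuclideanSpace ℝ (Fin N))))

/-- The finite element space `S_h`: continuous functions that are affine on each `N`-simplex and
vanish outside `Ω`. -/
def feSpace (Ω : Set (EuclideanSpace ℝ (Fin N)))
    (𝒯 : Geometry.SimplicialComplex ℝ (EuclideanSpace ℝ (Fin N))) :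
    Set (EuclideanSpace ℝ (Fin N) → ℝ) :=
  {φ | Continuous φ ∧
    (∀ K ∈ cells 𝒯, ∃ A : EuclideanSpace ℝ (Fin N) →ᵃ[ℝ] ℝ,
      ∀ x ∈ convexHull ℝ (K : Set (EuclideanSpace ℝ (Fin N))), φ x = A x) ∧
    ∀ x, x ∉ Ω → φ x = 0}

open Classical in
/-- The piecewise linear interpolant `Π_h v`: the (unique) element of `S_h` that takes the values
of `v` at the vertices in `Ω`. -/
def interp (Ω : Set (EuclideanSpace ℝ (Fin N)))
    (𝒯 : Geometry.SimplicialComplex ℝ (EuclideanSpace ℝ (Fin N)))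
    (v : EuclideanSpace ℝ (Fin N) → ℝ) : EuclideanSpace ℝ (Fin N) → ℝ :=
  if h : ∃ g ∈ feSpace Ω 𝒯, ∀ a ∈ 𝒯.vertices, a ∈ Ω → g a = v a then h.choose else 0

open Classical in
/-- The `H^s`-projection `P_h v`: the (unique) element of `S_h` such that `v - P_h v` is
orthogonal to `S_h` with respect to `hsForm s`. Only used for `v ∈ H^s`. -/
def hsProj (Ω : Set (EuclideanSpace ℝ (Fin N)))
    (𝒯 : Geometry.SimplicialComplex ℝ (EuclideanSpace ℝ (Fin N))) (s : ℝ)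
    (v : EuclideanSpace ℝ (Fin N) → ℝ) : EuclideanSpace ℝ (Fin N) → ℝ :=
  if h : ∃ g ∈ feSpace Ω 𝒯, ∀ χ ∈ feSpace Ω 𝒯, hsForm s (fun x => v x - g x) χ = 0
  then h.choose else 0

/-! ### The continuous and the discrete problem -/

/-- Admissible test functions for the evolution problem: Lipschitz in `(t,x)`, vanishing outside
`Ω` and at the final time `T`. -/
def IsTestFunction (Ω : Set (EuclideanSpace ℝ (Fin N))) (T : ℝ)
    (φ : ℝ → EuclideanSpace ℝ (Fin N) → ℝ) : Prop :=
  (∃ L : ℝ≥0, LipschitzWith L (Function.uncurry φ)) ∧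
  (∀ t x, x ∉ Ω → φ t x = 0) ∧ ∀ x, φ T x = 0

/-- `u` (first argument: time) is a weak solution of `u_t = -(-Δ)^s (|u|^(m-1) u)` in `Ω × (0,T]`,
`u = 0` outside `Ω`, with initial value `u₀`. -/
structure IsWeakSolution (Ω : Set (EuclideanSpace ℝ (Fin N))) (s m T : ℝ)
    (u₀ : EuclideanSpace ℝ (Fin N) → ℝ) (u : ℝ → EuclideanSpace ℝ (Fin N) → ℝ) : Prop where
  measurable : Measurable (Function.uncurry u)
  eq_zero : ∀ t ∈ Icc 0 T, ∀ x, x ∉ Ω → u t x = 0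
  /-- `u ∈ C([0,T]; L¹)`. -/
  integrable : ∀ t ∈ Icc 0 T, Integrable (u t)
  continuous_L1 : ∀ t₀ ∈ Icc 0 T,
    Tendsto (fun t => eLpNorm (u t - u t₀) 1 volume) (𝓝[Icc 0 T] t₀) (𝓝 0)
  /-- `|u|^(m-1) u ∈ L²(0,T; H^s)`. -/
  energy : ∫⁻ t in Ioo 0 T, (eLpNorm (fun x => spow m (u t x)) 2 volume ^ 2
    + hsSeminormSq s (fun x => spow m (u t x))) < ∞
  weak_eq : ∀ φ : ℝ → EuclideanSpace ℝ (Fin N) → ℝ, IsTestFunction Ω T φ →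
    -(∫ t in Ioo 0 T, ∫ x, u t x * deriv (fun r => φ r x) t)
      + ∫ t in Ioo 0 T, hsForm s (fun x => spow m (u t x)) (φ t)
      = ∫ x, u₀ x * φ 0 x

/-- `W₀, W₁, …, W_M` solve the fully discrete scheme with time step `τ`, started from
`W₀ = ψ⁻¹(Π_h ψ(w₀))`. -/
structure IsDiscreteSolution (Ω : Set (EuclideanSpace ℝ (Fin N)))
    (𝒯 : Geometry.SimplicialComplex ℝ (EuclideanSpace ℝ (Fin N))) (s m τ : ℝ) (M : ℕ)
    (w₀ : EuclideanSpace ℝ (Fin N) → ℝ) (W : ℕ → EuclideanSpace ℝ (Fin N) → ℝ) : Prop where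
  initial : W 0 = fun x => spow m (interp Ω 𝒯 (fun y => psi m (w₀ y)) x)
  mem : ∀ n < M, W (n + 1) ∈ feSpace Ω 𝒯
  step : ∀ n < M, ∀ χ ∈ feSpace Ω 𝒯,
    (∫ x, (psi m (W (n + 1) x) - psi m (W n x)) / τ * χ x) + hsForm s (W (n + 1)) χ = 0

/-- The piecewise constant in time function equal to `W₀` at `t = 0` and to `W_n` on
`((n-1)τ, nτ]`. -/
def discreteFun (τ : ℝ) (W : ℕ → EuclideanSpace ℝ (Fin N) → ℝ) (t : ℝ) :
    EuclideanSpace ℝ (Fin N) → ℝ :=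
  W ⌈t / τ⌉₊

/-- The time average `w̄ⁿ(x) = τ⁻¹ ∫_{I_n} w(x,t) dt` over `I_n = ((n-1)τ, nτ)`, for `n ≥ 1`. -/
def timeAvg (τ : ℝ) (w : ℝ → EuclideanSpace ℝ (Fin N) → ℝ) (n : ℕ) :
    EuclideanSpace ℝ (Fin N) → ℝ :=
  fun x => τ⁻¹ * ∫ t in Ioo (((n : ℝ) - 1) * τ) (n * τ), w t x

end FracDiffusion

end

open FracDiffusion

/-!
The proof is an energy argument for time-integrated equations. Put `r = 1/m`, so that `ψ` is the
odd power with exponent `r`, and let `Q(a, x) = (|a| + |x|)^(r-1) x²` be the integrand of the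
quasi-norm.

Testing the weak formulation with a finite element function times a cut-off in time
(`IsWeakSolution.integral_mul_add`), and subtracting the discrete scheme, one gets for every `χ ∈
S_h` the equation `(e_{n+1} - e_n, χ) + a(δ_n, χ) = 0` (`error_equation`), where `e_n = u(t_n) -
ψ(W_n)` and `δ_n = ∫_{I_{n+1}} (P_h w - W) dt` lies in `S_h`. Testing with `δ_n` and summing by
parts (`sum_add_half_le`) controls `∑ (e_{n+1}, δ_n) + |D|²/2` by `(e_0, D)`, where `D = ∑ δ_n`.
The fractional Poincaré inequality (`exists_poincare`) absorbs `D` on the right and leaves the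
`L²` norm of the initial error.

The quasi-norm enters only pointwise: `(ψ(w_n) - ψ(W_n)) (P_h w - W_n)` is bounded below by a
multiple of `Q(w, w - W_n)`, up to multiples of `Q(w, w - P_h w)` and `Q(w, w_n - w)`
(`exists_quasiIntegrand_le`). This follows from the two-sided bound of `|ψ(a) - ψ(b)|` by `(|a| +
|a-b|)^(r-1) |a-b|` and Young's inequality for shifted N-functions. No bound for `u` is needed:
`u(t_n)` is integrable and finite element functions are bounded, so the pairings converge, and the
`Q`-terms are handled as integrals in `[0,∞]`.

The projection `P_h` is written in a basis of the finite-dimensional space `S_h` and its dual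
basis with respect to `a` (`exists_hsProj_eq_sum`). This gives the measurability of `t ↦ P_h w(t)`
and, with Fubini's theorem (`hsForm_integral`), the commutation of `P_h` with time averages.
Finite element functions are Lipschitz (`exists_lipschitzWith_of_mem_feSpace`), hence admissible
test functions and elements of `H^s`.
-/

namespace FracDiffusion

/-! ### Scalar inequalities for the quasi-norm -/

/-- The derivative `t ↦ (a + t)^(r-1) t` of the N-function that underlies the quasi-norm, shifted
by `a ≥ 0`. With `r = 1/m` the integrand of `‖v₂‖²_{(v₁,(m+1)/m)}` is
`shiftedPow r |v₁| |v₂| * |v₂|`. -/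
noncomputable def shiftedPow (r a t : ℝ) : ℝ := (a + t) ^ (r - 1) * t

theorem shiftedPow_nonneg {r a t : ℝ} (ha : 0 ≤ a) (ht : 0 ≤ t) : 0 ≤ shiftedPow r a t :=
  mul_nonneg (Real.rpow_nonneg (add_nonneg ha ht) _) ht

theorem shiftedPow_mul_le {r a t μ : ℝ} (hr : 0 < r) (ha : 0 ≤ a) (ht : 0 ≤ t) (hμ0 : 0 ≤ μ)
    (hμ1 : μ ≤ 1) : shiftedPow r a (μ * t) ≤ μ ^ min r 1 * shiftedPow r a t := by
  rcases ht.eq_or_lt with rfl | ht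
  · simp [shiftedPow]
  rcases hμ0.eq_or_lt with rfl | hμ0
  · have : min r 1 ≠ 0 := (lt_min hr one_pos).ne'
    simp [shiftedPow, Real.zero_rpow this]
  have hat : 0 < a + t := by positivity
  unfold shiftedPow
  rcases le_total 1 r with h | h
  · rw [min_eq_right h, Real.rpow_one]
    have : (a + μ * t) ^ (r - 1) ≤ (a + t) ^ (r - 1) :=
      Real.rpow_le_rpow (by positivity) (by nlinarith) (by linarith)
    nlinarith [mul_pos hμ0 ht]
  · rw [min_eq_left h]
    have h1 : (a + μ * t) ^ (r - 1) ≤ (μ * (a + t)) ^ (r - 1) :=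
      Real.rpow_le_rpow_of_nonpos (by positivity) (by nlinarith) (by linarith)
    rw [Real.mul_rpow hμ0.le hat.le] at h1
    have h2 : μ ^ r = μ ^ (r - 1) * μ := by
      rw [← Real.rpow_add_one hμ0.ne']; congr 1; ring
    calc _ ≤ (μ ^ (r - 1) * (a + t) ^ (r - 1)) * (μ * t) := by gcongr
      _ = _ := by rw [h2]; ring

theorem shiftedPow_mono {r a t t' : ℝ} (hr : 0 < r) (ha : 0 ≤ a) (ht : 0 ≤ t) (h : t ≤ t') :
    shiftedPow r a t ≤ shiftedPow r a t' := by
  rcases (ht.trans h).eq_or_lt with h0 | h0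
  · rw [show t = t' by linarith]
  have h1 := shiftedPow_mul_le (μ := t / t') hr ha h0.le (by positivity)
    (by rw [div_le_one h0]; exact h)
  rw [div_mul_cancel₀ _ h0.ne'] at h1
  refine h1.trans (mul_le_of_le_one_left (shiftedPow_nonneg ha h0.le) ?_)
  exact Real.rpow_le_one (by positivity) (by rw [div_le_one h0]; exact h) (le_min hr.le zero_le_one)

theorem shiftedPow_mul_le_of_one_le {r a t l : ℝ} (hr : 0 < r) (ha : 0 ≤ a) (ht : 0 ≤ t)
    (hl : 1 ≤ l) : shiftedPow r a (l * t) ≤ l ^ (r + 1) * shiftedPow r a t := by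
  rcases ht.eq_or_lt with rfl | ht
  · simp [shiftedPow]
  have hat : 0 < a + t := by positivity
  have hl0 : 0 < l := by positivity
  have hlp : l ^ (r + 1) = l ^ r * l := Real.rpow_add_one hl0.ne' r
  unfold shiftedPow
  have key : (a + l * t) ^ (r - 1) ≤ l ^ r * (a + t) ^ (r - 1) := by
    rcases le_total 1 r with h | h
    · have h1 : (a + l * t) ^ (r - 1) ≤ (l * (a + t)) ^ (r - 1) :=
        Real.rpow_le_rpow (by positivity) (by nlinarith) (by linarith)
      rw [Real.mul_rpow hl0.le hat.le] at h1
      refine h1.trans ?_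
      gcongr
      linarith
    · have h1 : (a + l * t) ^ (r - 1) ≤ (a + t) ^ (r - 1) :=
        Real.rpow_le_rpow_of_nonpos (by positivity) (by nlinarith) (by linarith)
      exact h1.trans (le_mul_of_one_le_left (by positivity) (Real.one_le_rpow hl hr.le))
  calc _ ≤ (l ^ r * (a + t) ^ (r - 1)) * (l * t) := by gcongr
    _ = _ := by rw [hlp]; ring

/-- Young's inequality for the shifted N-function, with the small constant at the argument of
`shiftedPow`. -/
theorem exists_shiftedPow_young_left {r ε : ℝ} (hr : 0 < r) (hε : 0 < ε) :
    ∃ C : ℝ, 0 < C ∧ ∀ a x y : ℝ, 0 ≤ a → 0 ≤ x → 0 ≤ y →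
      shiftedPow r a x * y ≤ ε * (shiftedPow r a x * x) + C * (shiftedPow r a y * y) := by
  set l : ℝ := max 1 ε⁻¹
  have hl : 1 ≤ l := le_max_left _ _
  have hl0 : 0 < l := by positivity
  refine ⟨l ^ (r + 1), by positivity, fun a x y ha hx hy => ?_⟩
  have hX := shiftedPow_nonneg (r := r) ha hx
  have hY := shiftedPow_nonneg (r := r) ha hy
  rcases le_total y (ε * x) with h | h
  · have : 0 ≤ l ^ (r + 1) * (shiftedPow r a y * y) := by positivity
    nlinarith
  · have h1 : x ≤ l * y := by
      calc x = ε⁻¹ * (ε * x) := by field_simp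
        _ ≤ l * y := mul_le_mul (le_max_right _ _) h (by positivity) hl0.le
    have h2 := (shiftedPow_mono hr ha hx h1).trans (shiftedPow_mul_le_of_one_le hr ha hy hl)
    have : 0 ≤ ε * (shiftedPow r a x * x) := by positivity
    nlinarith

/-- Young's inequality for the shifted N-function, with the small constant at the other
argument. -/
theorem exists_shiftedPow_young_right {r ε : ℝ} (hr : 0 < r) (hε : 0 < ε) :
    ∃ C : ℝ, 0 < C ∧ ∀ a x y : ℝ, 0 ≤ a → 0 ≤ x → 0 ≤ y →
      shiftedPow r a x * y ≤ C * (shiftedPow r a x * x) + ε * (shiftedPow r a y * y) := by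
  have hk : 0 < min r 1 := lt_min hr one_pos
  set μ : ℝ := min 1 (ε ^ (min r 1)⁻¹)
  have hμ0 : 0 < μ := lt_min one_pos (by positivity)
  have hμε : μ ^ min r 1 ≤ ε := by
    calc μ ^ min r 1 ≤ (ε ^ (min r 1)⁻¹) ^ min r 1 := by
          gcongr; exact min_le_right _ _
      _ = ε := by rw [← Real.rpow_mul hε.le, inv_mul_cancel₀ hk.ne', Real.rpow_one]
  refine ⟨μ⁻¹, by positivity, fun a x y ha hx hy => ?_⟩
  have hX := shiftedPow_nonneg (r := r) ha hx
  have hY := shiftedPow_nonneg (r := r) ha hy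
  rcases le_total x (μ * y) with h | h
  · have h2 := (shiftedPow_mono hr ha hx h).trans
      (shiftedPow_mul_le hr ha hy hμ0.le (min_le_left _ _))
    have h3 : shiftedPow r a x ≤ ε * shiftedPow r a y := h2.trans (by gcongr)
    have : 0 ≤ μ⁻¹ * (shiftedPow r a x * x) := by positivity
    nlinarith
  · have h1 : y ≤ μ⁻¹ * x := by
      rw [inv_mul_eq_div, le_div_iff₀ hμ0, mul_comm]; exact h
    have : 0 ≤ ε * (shiftedPow r a y * y) := by positivity
    nlinarith

/-- Powers of comparable positive numbers are comparable. -/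
theorem rpow_le_mul_rpow_of_comparable {A B l : ℝ} (e : ℝ) (hA : 0 < A) (hB : 0 < B) (hl : 1 ≤ l)
    (h1 : A ≤ l * B) (h2 : B ≤ l * A) : A ^ e ≤ l ^ |e| * B ^ e := by
  have hl0 : 0 < l := by positivity
  rcases le_total 0 e with he | he
  · rw [abs_of_nonneg he, ← Real.mul_rpow hl0.le hB.le]
    exact Real.rpow_le_rpow hA.le h1 he
  · rw [abs_of_nonpos he, Real.rpow_neg hl0.le, ← Real.inv_rpow hl0.le,
      ← Real.mul_rpow (by positivity) hB.le]
    refine Real.rpow_le_rpow_of_nonpos (by positivity) ?_ he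
    rw [inv_mul_eq_div, div_le_iff₀ hl0]; linarith

theorem spow_of_nonneg {r y : ℝ} (hr : 0 < r) (hy : 0 ≤ y) : spow r y = y ^ r := by
  rcases hy.eq_or_lt with rfl | hy
  · simp [spow, Real.zero_rpow hr.ne']
  · rw [spow, abs_of_pos hy, ← Real.rpow_add_one hy.ne']; congr 1; ring

theorem spow_neg (r y : ℝ) : spow r (-y) = -spow r y := by simp [spow]

theorem psi_eq_spow {m : ℝ} (hm : 0 < m) (y : ℝ) : psi m y = spow (1 / m) y := by
  unfold psi spow; congr 2; field_simp

theorem rpow_sub_rpow_bounds {r l t : ℝ} (hr : 0 < r) (hl : 0 ≤ l) (hlt : l ≤ t) (ht : 0 < t) :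
    min 1 r * (t ^ (r - 1) * (t - l)) ≤ t ^ r - l ^ r ∧
      t ^ r - l ^ r ≤ max 1 r * (t ^ (r - 1) * (t - l)) := by
  set x := l / t
  have hx0 : 0 ≤ x := by positivity
  have hx1 : x ≤ 1 := by rw [div_le_one ht]; exact hlt
  have hlx : l = t * x := by simp only [x]; field_simp
  have htr : t ^ r = t ^ (r - 1) * t := by
    rw [← Real.rpow_add_one ht.ne']; congr 1; ring
  have e1 : t ^ r - l ^ r = t ^ (r - 1) * t * (1 - x ^ r) := by
    rw [hlx, Real.mul_rpow ht.le hx0, htr]; ring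
  have e2 : t ^ (r - 1) * (t - l) = t ^ (r - 1) * t * (1 - x) := by rw [hlx]; ring
  have hp : 0 < t ^ (r - 1) * t := by positivity
  rw [e1, e2]
  suffices h : min 1 r * (1 - x) ≤ 1 - x ^ r ∧ 1 - x ^ r ≤ max 1 r * (1 - x) by
    constructor
    · nlinarith [h.1]
    · nlinarith [h.2]
  have hb : x = 1 + (x - 1) := by ring
  rcases le_total 1 r with h | h
  · rw [min_eq_left h, max_eq_right h]
    have h1 : x ^ r ≤ x := by
      simpa using Real.rpow_le_rpow_of_exponent_ge' hx0 hx1 zero_le_one h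
    have h2 : 1 + r * (x - 1) ≤ x ^ r := by
      have := one_add_mul_self_le_rpow_one_add (s := x - 1) (by linarith) h
      rwa [← hb] at this
    constructor <;> linarith
  · rw [min_eq_right h, max_eq_left h]
    have h1 : x ≤ x ^ r := by
      simpa using Real.rpow_le_rpow_of_exponent_ge' hx0 hx1 hr.le h
    have h2 : x ^ r ≤ 1 + r * (x - 1) := by
      have := rpow_one_add_le_one_add_mul_self (s := x - 1) (by linarith) hr.le h
      rwa [← hb] at this
    constructor <;> linarith

theorem exists_spow_sub_bounds {r : ℝ} (hr : 0 < r) :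
    ∃ c C : ℝ, 0 < c ∧ 0 < C ∧ ∀ a b : ℝ, b ≤ a → a ≠ b →
      c * ((|a| + |b|) ^ (r - 1) * (a - b)) ≤ spow r a - spow r b ∧
      spow r a - spow r b ≤ C * ((|a| + |b|) ^ (r - 1) * (a - b)) := by
  set K : ℝ := 2 ^ |r - 1|
  have hK : 0 < K := by positivity
  set c : ℝ := min (min 1 r * K⁻¹) ((2 : ℝ) ^ r)⁻¹
  set C : ℝ := max (max 1 r * K) 2
  have hc : 0 < c := lt_min (mul_pos (lt_min one_pos hr) (by positivity)) (by positivity)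
  have hC : 0 < C := lt_max_of_lt_right two_pos
  have pos : ∀ t l : ℝ, 0 ≤ l → l ≤ t → 0 < t →
      c * ((t + l) ^ (r - 1) * (t - l)) ≤ t ^ r - l ^ r ∧
      t ^ r - l ^ r ≤ C * ((t + l) ^ (r - 1) * (t - l)) := by
    intro t l hl hlt ht
    obtain ⟨h1, h2⟩ := rpow_sub_rpow_bounds hr hl hlt ht
    have k1 := rpow_le_mul_rpow_of_comparable (A := t + l) (B := t) (l := 2) (r - 1)
      (by positivity) ht one_le_two (by linarith) (by linarith)
    have k2 := rpow_le_mul_rpow_of_comparable (A := t) (B := t + l) (l := 2) (r - 1)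
      ht (by positivity) one_le_two (by linarith) (by linarith)
    have hd : 0 ≤ t - l := by linarith
    have hm : 0 < min 1 r := lt_min one_pos hr
    constructor
    · calc c * ((t + l) ^ (r - 1) * (t - l))
          ≤ (min 1 r * K⁻¹) * ((K * t ^ (r - 1)) * (t - l)) := by
            gcongr; exact min_le_left _ _
        _ = min 1 r * (t ^ (r - 1) * (t - l)) := by field_simp
        _ ≤ _ := h1
    · calc _ ≤ _ := h2
        _ ≤ max 1 r * ((K * (t + l) ^ (r - 1)) * (t - l)) := by gcongr
        _ = (max 1 r * K) * ((t + l) ^ (r - 1) * (t - l)) := by ring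
        _ ≤ _ := by gcongr; exact le_max_left _ _
  refine ⟨c, C, hc, hC, fun a b hba hne => ?_⟩
  have hlt : b < a := lt_of_le_of_ne hba hne.symm
  rcases le_total 0 b with hb | hb
  · have ha : 0 < a := by linarith
    rw [abs_of_pos ha, abs_of_nonneg hb, spow_of_nonneg hr ha.le, spow_of_nonneg hr hb]
    exact pos a b hb hba ha
  rcases le_total 0 a with ha | ha
  · obtain ⟨b', rfl⟩ : ∃ b', b = -b' := ⟨-b, by ring⟩
    have hb' : 0 ≤ b' := by linarith
    rw [abs_of_nonneg ha, abs_neg, abs_of_nonneg hb', spow_neg, spow_of_nonneg hr ha,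
      spow_of_nonneg hr hb', sub_neg_eq_add, sub_neg_eq_add]
    have hS : 0 < a + b' := by linarith
    have hSr : (a + b') ^ (r - 1) * (a + b') = (a + b') ^ r := by
      rw [← Real.rpow_add_one hS.ne']; congr 1; ring
    rw [hSr]
    have ha1 : a ^ r ≤ (a + b') ^ r := Real.rpow_le_rpow ha (by linarith) hr.le
    have hb1 : b' ^ r ≤ (a + b') ^ r := Real.rpow_le_rpow hb' (by linarith) hr.le
    have ha0 : 0 ≤ a ^ r := Real.rpow_nonneg ha r
    have hb0 : 0 ≤ b' ^ r := Real.rpow_nonneg hb' r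
    have hp : 0 < (a + b') ^ r := by positivity
    constructor
    · have h2 : ((2 : ℝ) ^ r)⁻¹ * (a + b') ^ r = ((a + b') / 2) ^ r := by
        rw [Real.div_rpow hS.le two_pos.le]; ring
      calc c * (a + b') ^ r ≤ ((2 : ℝ) ^ r)⁻¹ * (a + b') ^ r := by
            gcongr; exact min_le_right _ _
        _ = ((a + b') / 2) ^ r := h2
        _ ≤ a ^ r + b' ^ r := by
          rcases le_total a b' with h | h
          · have := Real.rpow_le_rpow (by positivity) (show (a + b') / 2 ≤ b' by linarith) hr.le
            linarith
          · have := Real.rpow_le_rpow (by positivity) (show (a + b') / 2 ≤ a by linarith) hr.le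
            linarith
    · calc a ^ r + b' ^ r ≤ 2 * (a + b') ^ r := by linarith
        _ ≤ _ := by gcongr; exact le_max_right _ _
  · obtain ⟨b', rfl⟩ : ∃ b', b = -b' := ⟨-b, by ring⟩
    obtain ⟨a', rfl⟩ : ∃ a', a = -a' := ⟨-a, by ring⟩
    have hb' : 0 < b' := by linarith
    have ha' : 0 ≤ a' := by linarith
    rw [abs_neg, abs_neg, abs_of_nonneg ha', abs_of_pos hb', spow_neg, spow_neg,
      spow_of_nonneg hr ha', spow_of_nonneg hr hb'.le]
    have := pos b' a' ha' (by linarith) hb'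
    rw [add_comm a' b', show -a' - -b' = b' - a' by ring,
      show -a' ^ r - -b' ^ r = b' ^ r - a' ^ r by ring]
    exact this

/-- The monotonicity of the nonlinearity, bounded below by the quasi-norm integrand, and the
matching upper bound for its increments. -/
theorem exists_spow_shiftedPow_bounds {r : ℝ} (hr : 0 < r) :
    ∃ c C : ℝ, 0 < c ∧ 0 < C ∧ ∀ a b : ℝ,
      c * (shiftedPow r |a| |a - b| * |a - b|) ≤ (spow r a - spow r b) * (a - b) ∧
      |spow r a - spow r b| ≤ C * shiftedPow r |a| |a - b| := by
  obtain ⟨c, C, hc, hC, h⟩ := exists_spow_sub_bounds hr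
  set K : ℝ := 2 ^ |r - 1|
  have hK : 0 < K := by positivity
  refine ⟨c * K⁻¹, C * K, by positivity, by positivity, fun a b => ?_⟩
  rcases eq_or_ne a b with rfl | hne
  · simp [shiftedPow]
  have hab : 0 < |a - b| := abs_pos.mpr (sub_ne_zero.mpr hne)
  have t1 : |b| ≤ |a| + |a - b| := by
    have := abs_sub_abs_le_abs_sub b a
    rw [abs_sub_comm] at this; linarith
  have t2 : |a - b| ≤ |a| + |b| := by simpa using abs_sub a b
  have hS : 0 < |a| + |b| := by linarith
  have hA : 0 < |a| + |a - b| := by have := abs_nonneg a; linarith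
  have k1 := rpow_le_mul_rpow_of_comparable (l := 2) (r - 1) hA hS one_le_two
    (by linarith [abs_nonneg b]) (by linarith)
  have k2 := rpow_le_mul_rpow_of_comparable (l := 2) (r - 1) hS hA one_le_two
    (by linarith) (by linarith [abs_nonneg b])
  -- both bounds, stated with `|a| + |b|` in place of `|a| + |a - b|`
  have key : c * ((|a| + |b|) ^ (r - 1) * |a - b|) ≤ |spow r a - spow r b| ∧
      |spow r a - spow r b| ≤ C * ((|a| + |b|) ^ (r - 1) * |a - b|) ∧
      (spow r a - spow r b) * (a - b) = |spow r a - spow r b| * |a - b| := by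
    rcases le_total b a with hle | hle
    · obtain ⟨h1, h2⟩ := h a b hle hne
      have hd : 0 ≤ a - b := by linarith
      have : 0 ≤ spow r a - spow r b := le_trans (by positivity) h1
      rw [abs_of_nonneg this, abs_of_nonneg hd]
      exact ⟨h1, h2, rfl⟩
    · obtain ⟨h1, h2⟩ := h b a hle hne.symm
      have hd : 0 ≤ b - a := by linarith
      have : 0 ≤ spow r b - spow r a := le_trans (by positivity) h1
      rw [abs_sub_comm (spow r a), abs_sub_comm a, abs_of_nonneg this, abs_of_nonneg hd,
        add_comm |a|]
      exact ⟨h1, h2, by ring⟩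
  obtain ⟨h1, h2, h3⟩ := key
  constructor
  · rw [h3, ← mul_assoc]
    gcongr
    refine le_trans ?_ h1
    unfold shiftedPow
    calc c * K⁻¹ * ((|a| + |a - b|) ^ (r - 1) * |a - b|)
        ≤ c * K⁻¹ * ((K * (|a| + |b|) ^ (r - 1)) * |a - b|) := by gcongr
      _ = _ := by field_simp
  · refine h2.trans ?_
    unfold shiftedPow
    calc C * ((|a| + |b|) ^ (r - 1) * |a - b|)
        ≤ C * ((K * (|a| + |a - b|) ^ (r - 1)) * |a - b|) := by gcongr
      _ = _ := by ring

/-- The integrand of the squared quasi-norm with exponent `p`. -/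
noncomputable def quasiIntegrand (p a x : ℝ) : ℝ := (|a| + |x|) ^ (p - 2) * |x| ^ 2

theorem quasiIntegrand_nonneg (p a x : ℝ) : 0 ≤ quasiIntegrand p a x := by
  unfold quasiIntegrand; positivity

theorem quasiIntegrand_eq {m : ℝ} (hm : 0 < m) (a x : ℝ) :
    quasiIntegrand ((m + 1) / m) a x = shiftedPow (1 / m) |a| |x| * |x| := by
  unfold quasiIntegrand shiftedPow
  rw [show (m + 1) / m - 2 = 1 / m - 1 by field_simp; ring]; ring

/-- The pointwise estimate behind the energy argument. Here `a`, `b`, `p`, `d` stand for the values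
of `w(t)`, `W_n`, `P_h w(t)` and `w(t_n)`; the product on the right is the one that the error
equation controls after integration. -/
theorem exists_quasiIntegrand_le {m : ℝ} (hm : 0 < m) :
    ∃ c C : ℝ, 0 < c ∧ 0 < C ∧ ∀ a b p d : ℝ,
      c * quasiIntegrand ((m + 1) / m) a (a - b) ≤ (psi m d - psi m b) * (p - b)
        + C * quasiIntegrand ((m + 1) / m) a (a - p)
        + C * quasiIntegrand ((m + 1) / m) a (d - a) := by
  have hr : 0 < 1 / m := by positivity
  obtain ⟨c, C, hc, hC, h⟩ := exists_spow_shiftedPow_bounds hr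
  obtain ⟨C₁, hC₁, y1⟩ := exists_shiftedPow_young_left (ε := c / (4 * C)) hr (by positivity)
  obtain ⟨C₂, hC₂, y2⟩ := exists_shiftedPow_young_right (ε := c / (4 * C)) hr (by positivity)
  obtain ⟨C₃, hC₃, y3⟩ := exists_shiftedPow_young_left (ε := 1) hr one_pos
  refine ⟨c / 2, C * (C₁ + C₂ + C₃ + 1), by positivity, by positivity, fun a b p d => ?_⟩
  simp only [quasiIntegrand_eq hm, psi_eq_spow hm]
  set r := 1 / m
  obtain ⟨hab1, hab2⟩ := h a b
  have had := (h a d).2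
  rw [abs_sub_comm d a]
  set X := shiftedPow r |a| |a - b| * |a - b|
  set Y := shiftedPow r |a| |a - p| * |a - p|
  set Z := shiftedPow r |a| |a - d| * |a - d|
  have hY : 0 ≤ Y := mul_nonneg (shiftedPow_nonneg (abs_nonneg _) (abs_nonneg _)) (abs_nonneg _)
  have hZ : 0 ≤ Z := mul_nonneg (shiftedPow_nonneg (abs_nonneg _) (abs_nonneg _)) (abs_nonneg _)
  have i1 : (spow r a - spow r b) * (a - p) ≤ c / 4 * X + C * C₁ * Y := by
    calc _ ≤ |spow r a - spow r b| * |a - p| := by rw [← abs_mul]; exact le_abs_self _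
      _ ≤ C * shiftedPow r |a| |a - b| * |a - p| := by gcongr
      _ = C * (shiftedPow r |a| |a - b| * |a - p|) := by ring
      _ ≤ C * (c / (4 * C) * X + C₁ * Y) := by
          gcongr; exact y1 _ _ _ (abs_nonneg _) (abs_nonneg _) (abs_nonneg _)
      _ = _ := by field_simp
  have i2 : (spow r a - spow r d) * (a - b) ≤ C * C₂ * Z + c / 4 * X := by
    calc _ ≤ |spow r a - spow r d| * |a - b| := by rw [← abs_mul]; exact le_abs_self _
      _ ≤ C * shiftedPow r |a| |a - d| * |a - b| := by gcongr
      _ = C * (shiftedPow r |a| |a - d| * |a - b|) := by ring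
      _ ≤ C * (C₂ * Z + c / (4 * C) * X) := by
          gcongr; exact y2 _ _ _ (abs_nonneg _) (abs_nonneg _) (abs_nonneg _)
      _ = _ := by field_simp
  have i3 : -((spow r a - spow r d) * (a - p)) ≤ C * Z + C * C₃ * Y := by
    calc _ ≤ |spow r a - spow r d| * |a - p| := by rw [← abs_mul]; exact neg_le_abs _
      _ ≤ C * shiftedPow r |a| |a - d| * |a - p| := by gcongr
      _ = C * (shiftedPow r |a| |a - d| * |a - p|) := by ring
      _ ≤ C * (1 * Z + C₃ * Y) := by
          gcongr; exact y3 _ _ _ (abs_nonneg _) (abs_nonneg _) (abs_nonneg _)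
      _ = _ := by ring
  have e : (spow r d - spow r b) * (p - b) = (spow r a - spow r b) * (a - b)
      - (spow r a - spow r b) * (a - p) - (spow r a - spow r d) * (a - b)
      + (spow r a - spow r d) * (a - p) := by ring
  have n1 : 0 ≤ C * C₂ * Y := by positivity
  have n2 : 0 ≤ C * Y := by positivity
  have n3 : 0 ≤ C * C₁ * Z := by positivity
  have n4 : 0 ≤ C * C₃ * Z := by positivity
  rw [e]
  linarith

theorem measurable_spow (r : ℝ) : Measurable (spow r) := by
  unfold spow; fun_prop

theorem continuous_spow {r : ℝ} (hr : 0 < r) : Continuous (spow r) := by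
  have e : spow r = fun y => max y 0 ^ r - max (-y) 0 ^ r := by
    funext y
    rcases le_total 0 y with h | h
    · rw [spow_of_nonneg hr h, max_eq_left h, max_eq_right (by linarith), Real.zero_rpow hr.ne',
        sub_zero]
    · have := spow_of_nonneg hr (neg_nonneg.mpr h)
      rw [spow_neg] at this
      rw [max_eq_right h, max_eq_left (by linarith), Real.zero_rpow hr.ne', ← this]; ring
  rw [e]
  exact ((continuous_id.max continuous_const).rpow_const fun _ => Or.inr hr.le).sub
    ((continuous_neg.max continuous_const).rpow_const fun _ => Or.inr hr.le)

theorem continuous_psi {m : ℝ} (hm : 0 < m) : Continuous (psi m) := by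
  rw [show psi m = spow (1 / m) from funext (psi_eq_spow hm)]
  exact continuous_spow (by positivity)

theorem psi_zero (m : ℝ) : psi m 0 = 0 := by simp [psi]

theorem measurable_quasiIntegrand (p : ℝ) :
    Measurable fun z : ℝ × ℝ => quasiIntegrand p z.1 z.2 := by
  unfold quasiIntegrand; fun_prop

variable {N : ℕ}

/-! ### The Gagliardo form -/

/-- The weighted difference `(v(x) - v(z)) / |x-z|^((N+2s)/2)`. It is linear in `v`, and `v` has
finite Gagliardo seminorm if and only if `hsDiff s v` is square integrable. -/
noncomputable def hsDiff (s : ℝ) (v : EuclideanSpace ℝ (Fin N) → ℝ)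
    (q : EuclideanSpace ℝ (Fin N) × EuclideanSpace ℝ (Fin N)) : ℝ :=
  (v q.1 - v q.2) / ‖q.1 - q.2‖ ^ (((N : ℝ) + 2 * s) / 2)

theorem hsDiff_mul (s : ℝ) (v χ : EuclideanSpace ℝ (Fin N) → ℝ)
    (q : EuclideanSpace ℝ (Fin N) × EuclideanSpace ℝ (Fin N)) :
    hsDiff s v q * hsDiff s χ q
      = (v q.1 - v q.2) * (χ q.1 - χ q.2) / ‖q.1 - q.2‖ ^ ((N : ℝ) + 2 * s) := by
  have h : ‖q.1 - q.2‖ ^ ((N : ℝ) + 2 * s) = ‖q.1 - q.2‖ ^ (((N : ℝ) + 2 * s) / 2) *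
      ‖q.1 - q.2‖ ^ (((N : ℝ) + 2 * s) / 2) := by
    rw [← sq, ← Real.rpow_natCast, ← Real.rpow_mul (norm_nonneg _)]
    congr 1; push_cast; ring
  rw [h, hsDiff, hsDiff, div_mul_div_comm]

theorem hsForm_eq (s : ℝ) (v χ : EuclideanSpace ℝ (Fin N) → ℝ) :
    hsForm s v χ = ∫ q, hsDiff s v q * hsDiff s χ q := by
  simp only [hsDiff_mul]; rfl

theorem hsSeminormSq_eq (s : ℝ) (v : EuclideanSpace ℝ (Fin N) → ℝ) :
    hsSeminormSq s v = ∫⁻ q, ENNReal.ofReal (hsDiff s v q ^ 2) := by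
  simp only [hsSeminormSq, sq, hsDiff_mul]

theorem hsDiff_add (s : ℝ) (v χ : EuclideanSpace ℝ (Fin N) → ℝ) :
    hsDiff s (v + χ) = hsDiff s v + hsDiff s χ := by
  funext q; simp only [hsDiff, Pi.add_apply]; ring

theorem hsDiff_sub (s : ℝ) (v χ : EuclideanSpace ℝ (Fin N) → ℝ) :
    hsDiff s (v - χ) = hsDiff s v - hsDiff s χ := by
  funext q; simp only [hsDiff, Pi.sub_apply]; ring

theorem hsDiff_smul (s c : ℝ) (v : EuclideanSpace ℝ (Fin N) → ℝ) :
    hsDiff s (c • v) = c • hsDiff s v := by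
  funext q; simp only [hsDiff, Pi.smul_apply, smul_eq_mul]; ring

theorem measurable_hsDiff (s : ℝ) {v : EuclideanSpace ℝ (Fin N) → ℝ} (hv : Measurable v) :
    Measurable (hsDiff s v) := by
  unfold hsDiff; fun_prop

theorem memLp_hsDiff (s : ℝ) {v : EuclideanSpace ℝ (Fin N) → ℝ} (hv : Measurable v)
    (h : hsSeminormSq s v < ∞) : MemLp (hsDiff s v) 2 := by
  rw [memLp_two_iff_integrable_sq (measurable_hsDiff s hv).aestronglyMeasurable]
  refine ⟨((measurable_hsDiff s hv).pow_const 2).aestronglyMeasurable, ?_⟩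
  rw [hasFiniteIntegral_iff_ofReal (ae_of_all _ fun q => sq_nonneg _), ← hsSeminormSq_eq]
  exact h

theorem ofReal_hsForm_self {s : ℝ} {v : EuclideanSpace ℝ (Fin N) → ℝ}
    (h : MemLp (hsDiff s v) 2) : ENNReal.ofReal (hsForm s v v) = hsSeminormSq s v := by
  rw [hsForm_eq, hsSeminormSq_eq]
  simp only [← sq]
  exact ofReal_integral_eq_lintegral_ofReal h.integrable_sq (ae_of_all _ fun q => sq_nonneg _)

theorem hsForm_self_nonneg (s : ℝ) (v : EuclideanSpace ℝ (Fin N) → ℝ) : 0 ≤ hsForm s v v := by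
  rw [hsForm_eq]; exact integral_nonneg fun q => mul_self_nonneg _

theorem hsForm_comm (s : ℝ) (v χ : EuclideanSpace ℝ (Fin N) → ℝ) :
    hsForm s v χ = hsForm s χ v := by
  simp only [hsForm_eq, mul_comm]

theorem hsForm_smul_left (s c : ℝ) (v χ : EuclideanSpace ℝ (Fin N) → ℝ) :
    hsForm s (c • v) χ = c * hsForm s v χ := by
  simp only [hsForm_eq, hsDiff_smul, Pi.smul_apply, smul_eq_mul, mul_assoc, integral_const_mul]

theorem hsForm_add_left {s : ℝ} {v v' χ : EuclideanSpace ℝ (Fin N) → ℝ}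
    (h : Integrable fun q => hsDiff s v q * hsDiff s χ q)
    (h' : Integrable fun q => hsDiff s v' q * hsDiff s χ q) :
    hsForm s (v + v') χ = hsForm s v χ + hsForm s v' χ := by
  simp only [hsForm_eq, hsDiff_add, Pi.add_apply, add_mul]
  exact integral_add h h'

theorem hsForm_sub_left {s : ℝ} {v v' χ : EuclideanSpace ℝ (Fin N) → ℝ}
    (h : Integrable fun q => hsDiff s v q * hsDiff s χ q)
    (h' : Integrable fun q => hsDiff s v' q * hsDiff s χ q) :
    hsForm s (v - v') χ = hsForm s v χ - hsForm s v' χ := by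
  simp only [hsForm_eq, hsDiff_sub, Pi.sub_apply, sub_mul]
  exact integral_sub h h'

theorem integrable_hsDiff_mul {s : ℝ} {v χ : EuclideanSpace ℝ (Fin N) → ℝ}
    (hv : MemLp (hsDiff s v) 2) (hχ : MemLp (hsDiff s χ) 2) :
    Integrable fun q => hsDiff s v q * hsDiff s χ q :=
  hv.integrable_mul hχ

/-- Two functions that agree almost everywhere give the same differences almost everywhere. -/
theorem hsDiff_congr_ae (s : ℝ) {v v' : EuclideanSpace ℝ (Fin N) → ℝ} (h : v =ᵐ[volume] v') :
    hsDiff s v =ᵐ[volume] hsDiff s v' := by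
  have h1 : ∀ᵐ q : EuclideanSpace ℝ (Fin N) × EuclideanSpace ℝ (Fin N), v q.1 = v' q.1 :=
    Measure.quasiMeasurePreserving_fst.ae h
  have h2 : ∀ᵐ q : EuclideanSpace ℝ (Fin N) × EuclideanSpace ℝ (Fin N), v q.2 = v' q.2 :=
    Measure.quasiMeasurePreserving_snd.ae h
  filter_upwards [h1, h2] with q e1 e2
  rw [hsDiff, hsDiff, e1, e2]

theorem hsSeminormSq_congr_ae (s : ℝ) {v v' : EuclideanSpace ℝ (Fin N) → ℝ}
    (h : v =ᵐ[volume] v') : hsSeminormSq s v = hsSeminormSq s v' := by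
  rw [hsSeminormSq_eq, hsSeminormSq_eq]
  exact lintegral_congr_ae ((hsDiff_congr_ae s h).mono fun q e => by simp only [e])

theorem hsSeminormSq_add_le (s : ℝ) (v : EuclideanSpace ℝ (Fin N) → ℝ)
    {χ : EuclideanSpace ℝ (Fin N) → ℝ} (hχ : Measurable χ) :
    hsSeminormSq s (v + χ) ≤ 2 * hsSeminormSq s v + 2 * hsSeminormSq s χ := by
  have hm : Measurable fun q => ENNReal.ofReal (hsDiff s χ q ^ 2) :=
    ((measurable_hsDiff s hχ).pow_const 2).ennreal_ofReal
  simp only [hsSeminormSq_eq, hsDiff_add]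
  rw [← lintegral_const_mul' _ _ ENNReal.ofNat_ne_top,
    ← lintegral_const_mul' _ _ ENNReal.ofNat_ne_top, ← lintegral_add_right _ (hm.const_mul _)]
  refine lintegral_mono fun q => ?_
  simp only [Pi.add_apply]
  rw [show (2 : ℝ≥0∞) = ENNReal.ofReal 2 by simp, ← ENNReal.ofReal_mul two_pos.le,
    ← ENNReal.ofReal_mul two_pos.le, ← ENNReal.ofReal_add (by positivity) (by positivity)]
  exact ENNReal.ofReal_le_ofReal (by nlinarith [sq_nonneg (hsDiff s v q - hsDiff s χ q)])

/-- **Fractional Poincaré inequality** on bounded sets: it suffices to keep, in the Gagliardo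
seminorm, the interaction of the set with a ball in its complement. -/
theorem exists_poincare (hN : 1 ≤ N) {s : ℝ} (hs : 0 < s) {Ω : Set (EuclideanSpace ℝ (Fin N))}
    (hΩ : Bornology.IsBounded Ω) :
    ∃ C : ℝ, 0 < C ∧ ∀ v : EuclideanSpace ℝ (Fin N) → ℝ, Measurable v → (∀ x, x ∉ Ω → v x = 0) →
      ∫⁻ x, ENNReal.ofReal (v x ^ 2) ≤ ENNReal.ofReal C * hsSeminormSq s v := by
  have : Nonempty (Fin N) := ⟨⟨0, hN⟩⟩
  obtain ⟨R, hR, hsub⟩ := hΩ.subset_ball_lt 0 0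
  obtain ⟨p, hp⟩ := exists_norm_eq (EuclideanSpace ℝ (Fin N)) (c := 2 * R) (by positivity)
  set B := Metric.ball p R
  have hB0 : 0 < volume B := Metric.measure_ball_pos volume p hR
  have hB1 : volume B < ∞ := measure_ball_lt_top
  set e : ℝ := (N : ℝ) + 2 * s
  have he : 0 < e := by positivity
  set k : ℝ := ((4 * R) ^ e)⁻¹
  have hk : 0 < k := by positivity
  set b : ℝ := (volume B).toReal
  have hb : 0 < b := ENNReal.toReal_pos hB0.ne' hB1.ne
  have hbB : ENNReal.ofReal b = volume B := ENNReal.ofReal_toReal hB1.ne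
  refine ⟨(k * b)⁻¹, by positivity, fun v hv hv0 => ?_⟩
  have key : ENNReal.ofReal (k * b) * ∫⁻ x, ENNReal.ofReal (v x ^ 2) ≤ hsSeminormSq s v := by
    have hm : Measurable fun q : EuclideanSpace ℝ (Fin N) × EuclideanSpace ℝ (Fin N) =>
        ENNReal.ofReal ((v q.1 - v q.2) ^ 2 / ‖q.1 - q.2‖ ^ e) := by fun_prop
    have h1 : hsSeminormSq s v
        = ∫⁻ x, ∫⁻ z, ENNReal.ofReal ((v x - v z) ^ 2 / ‖x - z‖ ^ e) := by
      unfold hsSeminormSq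
      exact lintegral_prod _ hm.aemeasurable
    rw [h1, ← lintegral_const_mul' _ _ ENNReal.ofReal_ne_top]
    refine lintegral_mono fun x => ?_
    by_cases hx : x ∈ Ω
    · calc ENNReal.ofReal (k * b) * ENNReal.ofReal (v x ^ 2)
          = ∫⁻ z in B, ENNReal.ofReal (k * v x ^ 2) := by
            rw [setLIntegral_const, ← hbB, ← ENNReal.ofReal_mul (by positivity),
              ← ENNReal.ofReal_mul (by positivity)]
            congr 1; ring
        _ ≤ ∫⁻ z in B, ENNReal.ofReal ((v x - v z) ^ 2 / ‖x - z‖ ^ e) := by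
            refine setLIntegral_mono' measurableSet_ball fun z hz => ENNReal.ofReal_le_ofReal ?_
            have hx' : ‖x‖ < R := by simpa using hsub hx
            have hz' : ‖z - p‖ < R := by simpa [B, dist_eq_norm] using hz
            have hz1 : R < ‖z‖ := by
              have := norm_sub_norm_le p z
              rw [norm_sub_rev] at this; linarith
            have hz2 : ‖z‖ < 3 * R := by
              have := norm_sub_norm_le z p; linarith
            have hzΩ : v z = 0 := hv0 z fun h => by
              have : ‖z‖ < R := by simpa using hsub h
              linarith
            have hd : ‖x - z‖ ≤ 4 * R := (norm_sub_le x z).trans (by linarith)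
            have hd0 : 0 < ‖x - z‖ := by
              have := norm_sub_norm_le z x
              rw [norm_sub_rev] at this; linarith
            rw [hzΩ, sub_zero, div_eq_mul_inv, mul_comm]
            exact mul_le_mul_of_nonneg_left
              (inv_anti₀ (by positivity) (Real.rpow_le_rpow hd0.le hd he.le)) (sq_nonneg _)
        _ ≤ _ := setLIntegral_le_lintegral _ _
    · simp [hv0 x hx]
  calc ∫⁻ x, ENNReal.ofReal (v x ^ 2)
      = ENNReal.ofReal (k * b)⁻¹ * (ENNReal.ofReal (k * b) * ∫⁻ x, ENNReal.ofReal (v x ^ 2)) := by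
        rw [← mul_assoc, ← ENNReal.ofReal_mul (by positivity), inv_mul_cancel₀ (by positivity),
          ENNReal.ofReal_one, one_mul]
    _ ≤ _ := by gcongr

/-- Integrability of the truncated kernel, in polar coordinates. -/
theorem integrable_min_div_rpow (hN : 1 ≤ N) {s : ℝ} (hs0 : 0 < s) (hs1 : s < 1) :
    Integrable fun x : EuclideanSpace ℝ (Fin N) =>
      min (‖x‖ ^ 2) 1 / ‖x‖ ^ ((N : ℝ) + 2 * s) := by
  have : Nonempty (Fin N) := ⟨⟨0, hN⟩⟩
  rw [integrable_fun_norm_addHaar (E := EuclideanSpace ℝ (Fin N)) volume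
    (f := fun y => min (y ^ 2) 1 / y ^ ((N : ℝ) + 2 * s)), finrank_euclideanSpace_fin,
    ← Ioc_union_Ioi_eq_Ioi (zero_le_one (α := ℝ))]
  have hpow : ∀ y : ℝ, 0 < y → y ^ (N - 1) = y ^ ((N : ℝ) - 1) := fun y hy => by
    rw [← Real.rpow_natCast, Nat.cast_sub hN, Nat.cast_one]
  refine IntegrableOn.union ?_ ?_
  · have h : IntegrableOn (fun y : ℝ => y ^ (1 - 2 * s)) (Ioc 0 1) := by
      have := intervalIntegral.intervalIntegrable_rpow' (a := 0) (b := 1) (r := 1 - 2 * s)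
        (by linarith)
      rwa [intervalIntegrable_iff_integrableOn_Ioc_of_le zero_le_one] at this
    refine h.congr_fun (fun y hy => ?_) measurableSet_Ioc
    beta_reduce
    have h2 : y ^ 2 ≤ 1 := pow_le_one₀ hy.1.le hy.2
    rw [min_eq_left h2, smul_eq_mul, hpow y hy.1, ← Real.rpow_natCast y 2, ← Real.rpow_sub hy.1,
      ← Real.rpow_add hy.1]
    congr 1; push_cast; ring
  · have h := integrableOn_Ioi_rpow_of_lt (a := -1 - 2 * s) (c := 1) (by linarith) one_pos
    refine h.congr_fun (fun y hy => ?_) measurableSet_Ioi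
    beta_reduce
    have hy0 : 0 < y := zero_lt_one.trans hy
    have h2 : 1 ≤ y ^ 2 := one_le_pow₀ (le_of_lt hy)
    rw [min_eq_right h2, smul_eq_mul, hpow y hy0, one_div, ← Real.rpow_neg hy0.le,
      ← Real.rpow_add hy0]
    congr 1; ring

/-- Lipschitz functions that vanish outside a bounded measurable set belong to `H^s`. -/
theorem memLp_hsDiff_of_lipschitz (hN : 1 ≤ N) {s : ℝ} (hs0 : 0 < s) (hs1 : s < 1)
    {Ω : Set (EuclideanSpace ℝ (Fin N))} (hΩ : Bornology.IsBounded Ω) (hΩm : MeasurableSet Ω)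
    {v : EuclideanSpace ℝ (Fin N) → ℝ} {L : ℝ≥0} (hL : LipschitzWith L v) {B : ℝ}
    (hB : ∀ x, |v x| ≤ B) (hv0 : ∀ x, x ∉ Ω → v x = 0) : MemLp (hsDiff s v) 2 := by
  refine memLp_hsDiff s hL.continuous.measurable ?_
  set f : EuclideanSpace ℝ (Fin N) → ℝ≥0∞ := fun h =>
    ENNReal.ofReal (min (‖h‖ ^ 2) 1 / ‖h‖ ^ ((N : ℝ) + 2 * s))
  have hfm : Measurable f := by fun_prop
  have hf : ∫⁻ h, f h < ∞ := by
    have := (integrable_min_div_rpow hN hs0 hs1).2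
    rwa [hasFiniteIntegral_iff_ofReal (ae_of_all _ fun h => by positivity)] at this
  set K : ℝ := max ((L : ℝ) ^ 2) ((2 * B) ^ 2)
  have hvΩ : volume Ω < ∞ := hΩ.measure_lt_top
  set g : EuclideanSpace ℝ (Fin N) → ℝ≥0∞ := Ω.indicator 1
  have hgm : Measurable g := measurable_one.indicator hΩm
  have hgi : ∫⁻ x, g x < ∞ := by
    simpa [g, lintegral_indicator hΩm] using hvΩ
  have bound : ∀ q : EuclideanSpace ℝ (Fin N) × EuclideanSpace ℝ (Fin N),
      ENNReal.ofReal ((v q.1 - v q.2) ^ 2 / ‖q.1 - q.2‖ ^ ((N : ℝ) + 2 * s))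
        ≤ ENNReal.ofReal K * (g q.1 * f (q.1 - q.2) + g q.2 * f (q.1 - q.2)) := by
    intro q
    have h1 : (v q.1 - v q.2) ^ 2 ≤ K * min (‖q.1 - q.2‖ ^ 2) 1 := by
      rcases min_cases (‖q.1 - q.2‖ ^ 2) 1 with h | h
      · rw [h.1]
        have hl : |v q.1 - v q.2| ≤ L * ‖q.1 - q.2‖ := by
          simpa [Real.dist_eq, dist_eq_norm] using hL.dist_le_mul q.1 q.2
        calc (v q.1 - v q.2) ^ 2 = |v q.1 - v q.2| ^ 2 := (sq_abs _).symm
          _ ≤ (L * ‖q.1 - q.2‖) ^ 2 := by gcongr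
          _ = (L : ℝ) ^ 2 * ‖q.1 - q.2‖ ^ 2 := by ring
          _ ≤ _ := by gcongr; exact le_max_left _ _
      · rw [h.1, mul_one]
        refine le_trans ?_ (le_max_right _ _)
        have hl : |v q.1 - v q.2| ≤ 2 * B := (abs_sub _ _).trans (by linarith [hB q.1, hB q.2])
        calc (v q.1 - v q.2) ^ 2 = |v q.1 - v q.2| ^ 2 := (sq_abs _).symm
          _ ≤ _ := by gcongr
    have h2 : ENNReal.ofReal ((v q.1 - v q.2) ^ 2 / ‖q.1 - q.2‖ ^ ((N : ℝ) + 2 * s))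
        ≤ ENNReal.ofReal K * f (q.1 - q.2) := by
      rw [← ENNReal.ofReal_mul (by positivity), ← mul_div_assoc]
      exact ENNReal.ofReal_le_ofReal (by gcongr)
    by_cases hq1 : q.1 ∈ Ω
    · refine h2.trans ?_
      gcongr
      simp [g, hq1]
    by_cases hq2 : q.2 ∈ Ω
    · refine h2.trans ?_
      gcongr
      simp [g, hq2]
    · simp [hv0 _ hq1, hv0 _ hq2]
  have hm1 : Measurable fun q : EuclideanSpace ℝ (Fin N) × EuclideanSpace ℝ (Fin N) =>
      g q.1 * f (q.1 - q.2) := by fun_prop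
  have hm2 : Measurable fun q : EuclideanSpace ℝ (Fin N) × EuclideanSpace ℝ (Fin N) =>
      g q.2 * f (q.1 - q.2) := by fun_prop
  refine (lintegral_mono bound).trans_lt ?_
  rw [lintegral_const_mul' _ _ ENNReal.ofReal_ne_top, lintegral_add_left hm1]
  refine ENNReal.mul_lt_top ENNReal.ofReal_lt_top (ENNReal.add_lt_top.mpr ⟨?_, ?_⟩)
  · rw [Measure.volume_eq_prod, lintegral_prod _ hm1.aemeasurable]
    have : ∀ x, ∫⁻ z, g x * f (x - z) = g x * ∫⁻ h, f h := fun x => by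
      rw [lintegral_const_mul _ (by fun_prop), lintegral_sub_left_eq_self f x]
    simp only [this]
    rw [lintegral_mul_const _ hgm]
    exact ENNReal.mul_lt_top hgi hf
  · rw [Measure.volume_eq_prod, lintegral_prod_symm _ hm2.aemeasurable]
    have : ∀ z, ∫⁻ x, g z * f (x - z) = g z * ∫⁻ h, f h := fun z => by
      rw [lintegral_const_mul _ (by fun_prop), lintegral_sub_right_eq_self f z]
    simp only [this]
    rw [lintegral_mul_const _ hgm]
    exact ENNReal.mul_lt_top hgi hf

/-! ### The finite element space -/

/-- A continuous function that is `L`-Lipschitz on each member of a finite closed cover is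
`L`-Lipschitz: along a segment its lower right slope is at most `L` times the speed. -/
theorem lipschitzWith_of_finite_closed_cover {E ι : Type*} [NormedAddCommGroup E] [NormedSpace ℝ E]
    [Finite ι] {F : ι → Set E} (hF : ∀ i, IsClosed (F i)) (hcov : ∀ x, ∃ i, x ∈ F i) {L : ℝ≥0}
    {f : E → ℝ} (hf : Continuous f) (hL : ∀ i, LipschitzOnWith L f (F i)) : LipschitzWith L f := by
  have key : ∀ x y, f y - f x ≤ L * dist x y := by
    intro x y
    set γ : ℝ → E := fun t => AffineMap.lineMap x y t
    have hγ : Continuous γ := AffineMap.lineMap_continuous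
    have hd : ∀ a b, dist (γ a) (γ b) = dist a b * dist x y := fun a b =>
      dist_lineMap_lineMap x y a b
    have h := image_le_of_liminf_slope_right_le_deriv_boundary (f := f ∘ γ) (a := 0) (b := 1)
      (hf.comp hγ).continuousOn (B := fun t => f x + L * dist x y * t)
      (B' := fun _ => L * dist x y) (by simp [γ]) (by fun_prop)
      (fun t _ => by
        simpa using (((hasDerivAt_id t).const_mul (L * dist x y)).const_add (f x)).hasDerivWithinAt)
      ?_ (x := 1) (by simp)
    · simp only [Function.comp, γ, AffineMap.lineMap_apply_one, mul_one] at h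
      linarith
    intro t _ r hr
    -- some member of the cover contains points of the segment arbitrarily close to the right of `t`
    obtain ⟨i, hi⟩ : ∃ i, ∃ᶠ z in 𝓝[>] t, γ z ∈ F i := by
      by_contra! hcon
      have : ∀ᶠ z in 𝓝[>] t, ∀ i, γ z ∉ F i := eventually_all.mpr fun i => by
        simpa [Filter.Frequently] using hcon i
      obtain ⟨z, hz⟩ := this.exists
      obtain ⟨i, hi⟩ := hcov (γ z)
      exact hz i hi
    have hti : γ t ∈ F i := (hF i).mem_of_frequently_of_tendsto hi
      (hγ.continuousAt.tendsto.mono_left nhdsWithin_le_nhds)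
    refine (hi.and_eventually self_mem_nhdsWithin).mono fun z ⟨hz, htz⟩ => lt_of_le_of_lt ?_ hr
    have htz' : 0 < z - t := sub_pos.mpr htz
    have h1 := (hL i).dist_le_mul _ hz _ hti
    rw [hd, Real.dist_eq, Real.dist_eq, abs_of_pos htz'] at h1
    rw [slope_def_field, div_le_iff₀ htz']
    calc (f ∘ γ) z - (f ∘ γ) t ≤ |f (γ z) - f (γ t)| := le_abs_self _
      _ ≤ L * ((z - t) * dist x y) := h1
      _ = _ := by ring
  refine LipschitzWith.of_dist_le_mul fun x y => ?_
  rw [Real.dist_eq, abs_sub_le_iff]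
  exact ⟨by rw [dist_comm]; exact key y x, key x y⟩

theorem IsConvexPolyhedralDomain.isOpen {Ω : Set (EuclideanSpace ℝ (Fin N))}
    (h : IsConvexPolyhedralDomain Ω) : IsOpen Ω := by
  obtain ⟨-, F, rfl⟩ := h
  exact isOpen_interior

theorem IsConvexPolyhedralDomain.isBounded {Ω : Set (EuclideanSpace ℝ (Fin N))}
    (h : IsConvexPolyhedralDomain Ω) : Bornology.IsBounded Ω := by
  obtain ⟨-, F, rfl⟩ := h
  exact (isBounded_convexHull.mpr F.finite_toSet.isBounded).subset interior_subset

theorem IsTriangulation.exists_cell {Ω : Set (EuclideanSpace ℝ (Fin N))} {κ : ℝ}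
    {𝒯 : Geometry.SimplicialComplex ℝ (EuclideanSpace ℝ (Fin N))} (h : IsTriangulation Ω κ 𝒯)
    {x : EuclideanSpace ℝ (Fin N)} (hx : x ∈ Ω) :
    ∃ K ∈ cells 𝒯, x ∈ convexHull ℝ (K : Set (EuclideanSpace ℝ (Fin N))) := by
  have hx' : x ∈ 𝒯.space := h.space_eq ▸ subset_closure hx
  obtain ⟨f, hf, hxf⟩ := Geometry.SimplicialComplex.mem_space_iff.mp hx'
  obtain ⟨K, hK, hfK⟩ := h.pure f hf
  exact ⟨K, hK, convexHull_mono (by exact_mod_cast hfK) hxf⟩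

section

variable {Ω : Set (EuclideanSpace ℝ (Fin N))} {κ : ℝ}
  {𝒯 : Geometry.SimplicialComplex ℝ (EuclideanSpace ℝ (Fin N))}

theorem zero_mem_feSpace : (0 : EuclideanSpace ℝ (Fin N) → ℝ) ∈ feSpace Ω 𝒯 :=
  ⟨continuous_zero, fun _ _ => ⟨0, fun _ _ => rfl⟩, fun _ _ => rfl⟩

theorem add_mem_feSpace {φ χ : EuclideanSpace ℝ (Fin N) → ℝ} (hφ : φ ∈ feSpace Ω 𝒯)
    (hχ : χ ∈ feSpace Ω 𝒯) : φ + χ ∈ feSpace Ω 𝒯 := by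
  refine ⟨hφ.1.add hχ.1, fun K hK => ?_, fun x hx => by simp [hφ.2.2 x hx, hχ.2.2 x hx]⟩
  obtain ⟨A, hA⟩ := hφ.2.1 K hK
  obtain ⟨B, hB⟩ := hχ.2.1 K hK
  exact ⟨A + B, fun x hx => by simp [hA x hx, hB x hx]⟩

theorem smul_mem_feSpace (c : ℝ) {φ : EuclideanSpace ℝ (Fin N) → ℝ} (hφ : φ ∈ feSpace Ω 𝒯) :
    c • φ ∈ feSpace Ω 𝒯 := by
  refine ⟨hφ.1.const_smul c, fun K hK => ?_, fun x hx => by simp [hφ.2.2 x hx]⟩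
  obtain ⟨A, hA⟩ := hφ.2.1 K hK
  exact ⟨c • A, fun x hx => by simp [hA x hx]⟩

variable (Ω 𝒯) in
/-- The space `S_h` as a subspace of all functions. -/
def feSubmodule : Submodule ℝ (EuclideanSpace ℝ (Fin N) → ℝ) where
  carrier := feSpace Ω 𝒯
  zero_mem' := zero_mem_feSpace
  add_mem' := add_mem_feSpace
  smul_mem' c _ := smul_mem_feSpace c

theorem exists_lipschitzWith_of_mem_feSpace (hΩ : IsOpen Ω) (h𝒯 : IsTriangulation Ω κ 𝒯)
    {φ : EuclideanSpace ℝ (Fin N) → ℝ} (hφ : φ ∈ feSpace Ω 𝒯) : ∃ L : ℝ≥0, LipschitzWith L φ := by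
  have hfin : Finite (cells 𝒯) := (h𝒯.finite.subset fun K hK => hK.1).to_subtype
  have hA : ∀ K : cells 𝒯, ∃ L : ℝ≥0, LipschitzOnWith L φ
      (convexHull ℝ (K.1 : Set (EuclideanSpace ℝ (Fin N)))) := by
    rintro ⟨K, hK⟩
    obtain ⟨A, hA⟩ := hφ.2.1 K hK
    have hlin := A.linear.toContinuousLinearMap.lipschitz
    refine ⟨_, LipschitzOnWith.of_dist_le_mul (K := ‖A.linear.toContinuousLinearMap‖₊)
      fun x hx y hy => ?_⟩
    have h := hlin.dist_le_mul (x - y) 0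
    rw [hA x hx, hA y hy, dist_eq_norm, dist_eq_norm, ← vsub_eq_sub (A x), ← A.linearMap_vsub]
    simpa using h
  choose L hL using hA
  have := Fintype.ofFinite (cells 𝒯)
  set L' : ℝ≥0 := ∑ K, L K
  refine ⟨L', lipschitzWith_of_finite_closed_cover (ι := Option (cells 𝒯))
    (F := fun o => o.elim Ωᶜ fun K =>
      convexHull ℝ (K.1 : Set (EuclideanSpace ℝ (Fin N)))) ?_ ?_ hφ.1 ?_⟩
  · rintro (_ | K)
    · exact hΩ.isClosed_compl
    · exact (K.1.finite_toSet.isCompact_convexHull (𝕜 := ℝ)).isClosed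
  · intro x
    by_cases hx : x ∈ Ω
    · obtain ⟨K, hK, hxK⟩ := h𝒯.exists_cell hx
      exact ⟨some ⟨K, hK⟩, hxK⟩
    · exact ⟨none, hx⟩
  · rintro (_ | K)
    · refine LipschitzOnWith.of_dist_le_mul fun x hx y hy => ?_
      rw [hφ.2.2 x hx, hφ.2.2 y hy, dist_self]
      positivity
    · exact (hL K).weaken (Finset.single_le_sum (fun _ _ => zero_le) (Finset.mem_univ K))

theorem hasCompactSupport_of_mem_feSpace (hb : Bornology.IsBounded Ω)
    {φ : EuclideanSpace ℝ (Fin N) → ℝ} (hφ : φ ∈ feSpace Ω 𝒯) : HasCompactSupport φ :=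
  HasCompactSupport.intro hb.isCompact_closure fun x hx =>
    hφ.2.2 x fun h => hx (subset_closure h)

theorem exists_bound_of_mem_feSpace (hb : Bornology.IsBounded Ω)
    {φ : EuclideanSpace ℝ (Fin N) → ℝ} (hφ : φ ∈ feSpace Ω 𝒯) : ∃ C : ℝ, ∀ x, |φ x| ≤ C :=
  hφ.1.bounded_above_of_compact_support (hasCompactSupport_of_mem_feSpace hb hφ)

theorem integrable_mul_of_mem_feSpace (hb : Bornology.IsBounded Ω)
    {f φ : EuclideanSpace ℝ (Fin N) → ℝ} (hf : Integrable f) (hφ : φ ∈ feSpace Ω 𝒯) :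
    Integrable fun x => f x * φ x := by
  obtain ⟨C, hC⟩ := exists_bound_of_mem_feSpace hb hφ
  exact hf.mul_bdd hφ.1.aestronglyMeasurable (ae_of_all _ hC)

theorem integrable_of_mem_feSpace (hb : Bornology.IsBounded Ω)
    {φ : EuclideanSpace ℝ (Fin N) → ℝ} (hφ : φ ∈ feSpace Ω 𝒯) : Integrable φ :=
  hφ.1.integrable_of_hasCompactSupport (hasCompactSupport_of_mem_feSpace hb hφ)

theorem integrable_psi_of_mem_feSpace (hb : Bornology.IsBounded Ω) {m : ℝ} (hm : 0 < m)
    {φ : EuclideanSpace ℝ (Fin N) → ℝ} (hφ : φ ∈ feSpace Ω 𝒯) :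
    Integrable fun x => psi m (φ x) :=
  ((continuous_psi hm).comp hφ.1).integrable_of_hasCompactSupport
    ((hasCompactSupport_of_mem_feSpace hb hφ).comp_left (psi_zero m))

theorem memLp_hsDiff_of_mem_feSpace (hN : 1 ≤ N) {s : ℝ} (hs0 : 0 < s) (hs1 : s < 1)
    (hΩ : IsOpen Ω) (hb : Bornology.IsBounded Ω) (h𝒯 : IsTriangulation Ω κ 𝒯)
    {φ : EuclideanSpace ℝ (Fin N) → ℝ} (hφ : φ ∈ feSpace Ω 𝒯) : MemLp (hsDiff s φ) 2 := by
  obtain ⟨L, hL⟩ := exists_lipschitzWith_of_mem_feSpace hΩ h𝒯 hφ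
  obtain ⟨C, hC⟩ := exists_bound_of_mem_feSpace hb hφ
  exact memLp_hsDiff_of_lipschitz hN hs0 hs1 hb hΩ.measurableSet hL hC hφ.2.2

theorem interp_mem_feSpace (v : EuclideanSpace ℝ (Fin N) → ℝ) :
    interp Ω 𝒯 v ∈ feSpace Ω 𝒯 := by
  unfold interp
  split_ifs with h
  · exact h.choose_spec.1
  · exact zero_mem_feSpace

/-- A finite element function that vanishes at all vertices is zero. -/
theorem eq_zero_of_mem_feSpace (h𝒯 : IsTriangulation Ω κ 𝒯)
    {φ : EuclideanSpace ℝ (Fin N) → ℝ} (hφ : φ ∈ feSpace Ω 𝒯)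
    (h : ∀ a ∈ 𝒯.vertices, φ a = 0) : φ = 0 := by
  funext x
  by_cases hx : x ∈ Ω
  · obtain ⟨K, hK, hxK⟩ := h𝒯.exists_cell hx
    obtain ⟨A, hA⟩ := hφ.2.1 K hK
    have hsub : convexHull ℝ (K : Set (EuclideanSpace ℝ (Fin N))) ⊆ A ⁻¹' {0} := by
      refine convexHull_min (fun a ha => ?_) ((convex_singleton 0).affine_preimage A)
      have hav : a ∈ 𝒯.vertices := 𝒯.down_closed hK.1 (Finset.singleton_subset_iff.mpr ha)
        (Finset.singleton_nonempty a)
      rw [mem_preimage, mem_singleton_iff, ← hA a (subset_convexHull ℝ _ ha), h a hav]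
    rw [hA x hxK]
    exact hsub hxK
  · exact hφ.2.2 x hx

theorem finiteDimensional_feSubmodule (h𝒯 : IsTriangulation Ω κ 𝒯) :
    FiniteDimensional ℝ (feSubmodule Ω 𝒯) := by
  have : Finite 𝒯.vertices :=
    (h𝒯.finite.preimage Finset.singleton_injective.injOn).to_subtype
  let ev : feSubmodule Ω 𝒯 →ₗ[ℝ] (𝒯.vertices → ℝ) :=
    (LinearMap.funLeft ℝ ℝ ((↑) : 𝒯.vertices → EuclideanSpace ℝ (Fin N))).comp
      (feSubmodule Ω 𝒯).subtype
  refine FiniteDimensional.of_injective ev ?_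
  rw [injective_iff_map_eq_zero]
  rintro ⟨φ, hφ⟩ h
  ext1
  exact eq_zero_of_mem_feSpace h𝒯 hφ fun a ha => congrFun h ⟨a, ha⟩

/-- On `S_h` the Gagliardo form is definite, by the Poincaré inequality. -/
theorem eq_zero_of_hsForm_self_eq_zero (hN : 1 ≤ N) {s : ℝ} (hs0 : 0 < s) (hs1 : s < 1)
    (hΩ : IsOpen Ω) (hb : Bornology.IsBounded Ω) (h𝒯 : IsTriangulation Ω κ 𝒯)
    {φ : EuclideanSpace ℝ (Fin N) → ℝ} (hφ : φ ∈ feSpace Ω 𝒯) (h : hsForm s φ φ = 0) : φ = 0 := by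
  obtain ⟨C, -, hC⟩ := exists_poincare hN hs0 hb
  have h1 := hC φ hφ.1.measurable hφ.2.2
  rw [← ofReal_hsForm_self (memLp_hsDiff_of_mem_feSpace hN hs0 hs1 hΩ hb h𝒯 hφ), h,
    ENNReal.ofReal_zero, mul_zero, nonpos_iff_eq_zero,
    lintegral_eq_zero_iff (hφ.1.measurable.pow_const 2).ennreal_ofReal] at h1
  refine (Continuous.ae_eq_iff_eq volume hφ.1 continuous_zero).mp (h1.mono fun x hx => ?_)
  have h2 : φ x ^ 2 ≤ 0 := ENNReal.ofReal_eq_zero.mp hx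
  exact pow_eq_zero_iff two_ne_zero |>.mp (le_antisymm h2 (sq_nonneg _))

/-- The Gagliardo form on `S_h`. -/
noncomputable def feForm (s : ℝ) (h : ∀ φ ∈ feSpace Ω 𝒯, MemLp (hsDiff s φ) 2) :
    LinearMap.BilinForm ℝ (feSubmodule Ω 𝒯) :=
  have hi : ∀ φ χ : feSubmodule Ω 𝒯, Integrable fun q => hsDiff s φ.1 q * hsDiff s χ.1 q :=
    fun φ χ => integrable_hsDiff_mul (h _ φ.2) (h _ χ.2)
  LinearMap.mk₂ ℝ (fun φ χ => hsForm s φ.1 χ.1)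
    (fun φ φ' χ => hsForm_add_left (hi φ χ) (hi φ' χ))
    (fun c φ χ => hsForm_smul_left s c φ.1 χ.1)
    (fun φ χ χ' => by
      simp only [hsForm_comm s φ.1]
      exact hsForm_add_left (hi χ φ) (hi χ' φ))
    (fun c φ χ => by
      simp only [hsForm_comm s φ.1]
      exact hsForm_smul_left s c χ.1 φ.1)

theorem nondegenerate_feForm (hN : 1 ≤ N) {s : ℝ} (hs0 : 0 < s) (hs1 : s < 1)
    (hΩ : IsOpen Ω) (hb : Bornology.IsBounded Ω) (h𝒯 : IsTriangulation Ω κ 𝒯)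
    (h : ∀ φ ∈ feSpace Ω 𝒯, MemLp (hsDiff s φ) 2) : (feForm s h).Nondegenerate :=
  have key : ∀ φ : feSubmodule Ω 𝒯, hsForm s φ.1 φ.1 = 0 → φ = 0 := fun φ h0 =>
    Subtype.ext (eq_zero_of_hsForm_self_eq_zero hN hs0 hs1 hΩ hb h𝒯 φ.2 h0)
  ⟨fun φ h0 => key φ (h0 φ), fun φ h0 => key φ (h0 φ)⟩

/-- The `H^s`-projection in coordinates: there are a basis `b` of `S_h` and a dual basis `d` with
`P_h v = ∑ᵢ a(v, bᵢ) dᵢ`. The only requirement on `v` is that `a(v, χ)` converges absolutely for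
all `χ ∈ S_h`. -/
theorem exists_hsProj_eq_sum (hN : 1 ≤ N) {s : ℝ} (hs0 : 0 < s) (hs1 : s < 1)
    (hΩ : IsOpen Ω) (hb : Bornology.IsBounded Ω) (h𝒯 : IsTriangulation Ω κ 𝒯) :
    ∃ (k : ℕ) (b d : Fin k → EuclideanSpace ℝ (Fin N) → ℝ), (∀ i, b i ∈ feSpace Ω 𝒯) ∧
      (∀ i, d i ∈ feSpace Ω 𝒯) ∧ ∀ v : EuclideanSpace ℝ (Fin N) → ℝ,
        (∀ χ ∈ feSpace Ω 𝒯, Integrable fun q => hsDiff s v q * hsDiff s χ q) →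
          hsProj Ω 𝒯 s v = ∑ i, hsForm s v (b i) • d i ∧
          hsProj Ω 𝒯 s v ∈ feSpace Ω 𝒯 ∧
          ∀ χ ∈ feSpace Ω 𝒯, hsForm s (hsProj Ω 𝒯 s v) χ = hsForm s v χ := by
  have hL : ∀ φ ∈ feSpace Ω 𝒯, MemLp (hsDiff s φ) 2 := fun φ hφ =>
    memLp_hsDiff_of_mem_feSpace hN hs0 hs1 hΩ hb h𝒯 hφ
  have hfd := finiteDimensional_feSubmodule h𝒯
  have hnd := nondegenerate_feForm hN hs0 hs1 hΩ hb h𝒯 hL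
  set B := feForm s hL
  let e := Module.finBasis ℝ (feSubmodule Ω 𝒯)
  let d := B.dualBasis hnd e
  refine ⟨_, fun i => (e i).1, fun i => (d i).1, fun i => (e i).2, fun i => (d i).2,
    fun v hv => ?_⟩
  -- the functional `a(v, ·)` on `S_h` and its representative
  let l : feSubmodule Ω 𝒯 →ₗ[ℝ] ℝ :=
    { toFun := fun χ => hsForm s v χ.1
      map_add' := fun χ χ' => by
        simp only [hsForm_comm s v]
        exact hsForm_add_left (by simpa only [mul_comm] using hv χ.1 χ.2)
          (by simpa only [mul_comm] using hv χ'.1 χ'.2)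
      map_smul' := fun c χ => by
        simp only [hsForm_comm s v]
        exact hsForm_smul_left s c χ.1 v }
  let g : feSubmodule Ω 𝒯 := ∑ i, l (e i) • d i
  have hg : B g = l := by
    refine e.ext fun j => ?_
    simp only [g, map_sum, map_smul, LinearMap.sum_apply, LinearMap.smul_apply, d,
      LinearMap.BilinForm.apply_dualBasis_left, smul_eq_mul]
    simp
  have hsub : ∀ g' ∈ feSpace Ω 𝒯, ∀ χ ∈ feSpace Ω 𝒯,
      hsForm s (fun x => v x - g' x) χ = hsForm s v χ - hsForm s g' χ := fun g' hg' χ hχ =>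
    hsForm_sub_left (hv χ hχ) (integrable_hsDiff_mul (hL _ hg') (hL _ hχ))
  have hform : ∀ χ ∈ feSpace Ω 𝒯, hsForm s g.1 χ = hsForm s v χ := fun χ hχ =>
    LinearMap.congr_fun hg ⟨χ, hχ⟩
  have hex : ∃ g ∈ feSpace Ω 𝒯, ∀ χ ∈ feSpace Ω 𝒯, hsForm s (fun x => v x - g x) χ = 0 :=
    ⟨g.1, g.2, fun χ hχ => by rw [hsub _ g.2 χ hχ, hform χ hχ, sub_self]⟩
  have hproj : hsProj Ω 𝒯 s v = g.1 := by
    unfold hsProj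
    rw [dif_pos hex]
    obtain ⟨h1, h2⟩ := hex.choose_spec
    set g' := hex.choose
    have h3 : (⟨g', h1⟩ : feSubmodule Ω 𝒯) - g = 0 := by
      refine hnd.1 _ fun χ => ?_
      have e1 : B ⟨g', h1⟩ χ = hsForm s v χ.1 := by
        have := h2 χ.1 χ.2
        rw [hsub _ h1 _ χ.2] at this
        change hsForm s g' χ.1 = _
        linarith
      rw [map_sub, LinearMap.sub_apply, e1, hg]
      exact sub_self _
    exact congrArg Subtype.val (sub_eq_zero.mp h3)
  have hcoe : g.1 = ∑ i, hsForm s v (e i).1 • (d i).1 := by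
    simp [g, l]
  rw [hproj]
  exact ⟨hcoe, g.2, hform⟩

end

/-! ### Time integration of functions in `L²(0,T; H^s)` -/

section TimeIntegral

variable {s T : ℝ} {w : ℝ → EuclideanSpace ℝ (Fin N) → ℝ}

theorem measurable_uncurry_hsDiff (hw : Measurable (Function.uncurry w)) :
    Measurable fun p : ℝ × (EuclideanSpace ℝ (Fin N) × EuclideanSpace ℝ (Fin N)) =>
      hsDiff s (w p.1) p.2 := by
  have h1 : Measurable fun p : ℝ × (EuclideanSpace ℝ (Fin N) × EuclideanSpace ℝ (Fin N)) =>
      w p.1 p.2.1 := hw.comp (by fun_prop : Measurable fun p : ℝ × (EuclideanSpace ℝ (Fin N) ×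
        EuclideanSpace ℝ (Fin N)) => (p.1, p.2.1))
  have h2 : Measurable fun p : ℝ × (EuclideanSpace ℝ (Fin N) × EuclideanSpace ℝ (Fin N)) =>
      w p.1 p.2.2 := hw.comp (by fun_prop : Measurable fun p : ℝ × (EuclideanSpace ℝ (Fin N) ×
        EuclideanSpace ℝ (Fin N)) => (p.1, p.2.2))
  unfold hsDiff
  fun_prop

theorem lintegral_hsSeminormSq_lt_top
    (hE : ∫⁻ t in Ioo 0 T, (eLpNorm (w t) 2 volume ^ 2 + hsSeminormSq s (w t)) < ∞) :
    ∫⁻ t in Ioo 0 T, hsSeminormSq s (w t) < ∞ :=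
  (lintegral_mono fun _ => le_add_self).trans_lt hE

theorem ae_memLp_hsDiff (hw : Measurable (Function.uncurry w))
    (hE : ∫⁻ t in Ioo 0 T, (eLpNorm (w t) 2 volume ^ 2 + hsSeminormSq s (w t)) < ∞) :
    ∀ᵐ t ∂volume.restrict (Ioo 0 T), MemLp (hsDiff s (w t)) 2 := by
  have hm : Measurable fun t => hsSeminormSq s (w t) := by
    simp only [hsSeminormSq_eq]
    exact ((measurable_uncurry_hsDiff hw).pow_const 2).ennreal_ofReal.lintegral_prod_right'
  filter_upwards [ae_lt_top hm (lintegral_hsSeminormSq_lt_top hE).ne] with t ht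
  exact memLp_hsDiff s hw.of_uncurry_left ht

theorem ae_integrableOn_time (hw : Measurable (Function.uncurry w))
    (hE : ∫⁻ t in Ioo 0 T, (eLpNorm (w t) 2 volume ^ 2 + hsSeminormSq s (w t)) < ∞) :
    ∀ᵐ x, IntegrableOn (fun t => w t x) (Ioo 0 T) := by
  have h1 : ∫⁻ t in Ioo 0 T, ∫⁻ x, ENNReal.ofReal (w t x ^ 2) < ∞ := by
    refine (lintegral_mono fun t => ?_).trans_lt hE
    refine le_trans (le_of_eq ?_) le_self_add
    have := eLpNorm_nnreal_pow_eq_lintegral (f := w t) (p := 2) (μ := volume) two_ne_zero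
    norm_num at this
    rw [this]
    refine lintegral_congr fun x => ?_
    rw [Real.enorm_eq_ofReal_abs, ← ENNReal.ofReal_pow (abs_nonneg _), sq_abs]
  have hm : Measurable fun p : ℝ × EuclideanSpace ℝ (Fin N) =>
      ENNReal.ofReal (w p.1 p.2 ^ 2) := (hw.pow_const 2).ennreal_ofReal
  rw [← lintegral_prod _ hm.aemeasurable, lintegral_prod_symm _ hm.aemeasurable] at h1
  filter_upwards [ae_lt_top hm.lintegral_prod_left' h1.ne] with x hx
  have hmx : Measurable fun t => w t x := hw.of_uncurry_right
  have : MemLp (fun t => w t x) 2 (volume.restrict (Ioo 0 T)) := by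
    rw [memLp_two_iff_integrable_sq hmx.aestronglyMeasurable]
    refine ⟨(hmx.pow_const 2).aestronglyMeasurable, ?_⟩
    rwa [hasFiniteIntegral_iff_ofReal (ae_of_all _ fun q => sq_nonneg _)]
  exact this.integrable (by norm_num)

theorem integrable_prod_hsDiff_mul (hw : Measurable (Function.uncurry w))
    (hE : ∫⁻ t in Ioo 0 T, (eLpNorm (w t) 2 volume ^ 2 + hsSeminormSq s (w t)) < ∞)
    {χ : EuclideanSpace ℝ (Fin N) → ℝ} (hχ : MemLp (hsDiff s χ) 2) :
    Integrable (fun p : ℝ × (EuclideanSpace ℝ (Fin N) × EuclideanSpace ℝ (Fin N)) =>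
      hsDiff s (w p.1) p.2 * hsDiff s χ p.2) ((volume.restrict (Ioo 0 T)).prod volume) := by
  have hm := measurable_uncurry_hsDiff (s := s) hw
  refine MemLp.integrable_mul (p := 2) (q := 2) ?_
    (hχ.comp_snd (volume.restrict (Ioo 0 T)))
  rw [memLp_two_iff_integrable_sq hm.aestronglyMeasurable]
  refine ⟨(hm.pow_const 2).aestronglyMeasurable, ?_⟩
  rw [hasFiniteIntegral_iff_ofReal (ae_of_all _ fun q => sq_nonneg _),
    lintegral_prod _ (hm.pow_const 2).ennreal_ofReal.aemeasurable]
  simpa only [hsSeminormSq_eq] using lintegral_hsSeminormSq_lt_top hE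

theorem integrableOn_hsForm (hw : Measurable (Function.uncurry w))
    (hE : ∫⁻ t in Ioo 0 T, (eLpNorm (w t) 2 volume ^ 2 + hsSeminormSq s (w t)) < ∞)
    {χ : EuclideanSpace ℝ (Fin N) → ℝ} (hχ : MemLp (hsDiff s χ) 2) :
    IntegrableOn (fun t => hsForm s (w t) χ) (Ioo 0 T) := by
  simp only [hsForm_eq]
  exact (integrable_prod_hsDiff_mul hw hE hχ).integral_prod_left

/-- The Gagliardo form commutes with integration in time. -/
theorem hsForm_integral (hw : Measurable (Function.uncurry w))
    (hE : ∫⁻ t in Ioo 0 T, (eLpNorm (w t) 2 volume ^ 2 + hsSeminormSq s (w t)) < ∞)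
    {χ : EuclideanSpace ℝ (Fin N) → ℝ} (hχ : MemLp (hsDiff s χ) 2) {I : Set ℝ}
    (hI : I ⊆ Ioo 0 T) :
    (Integrable fun q => hsDiff s (fun x => ∫ t in I, w t x) q * hsDiff s χ q) ∧
      hsForm s (fun x => ∫ t in I, w t x) χ = ∫ t in I, hsForm s (w t) χ := by
  have hint : Integrable (fun p : ℝ × (EuclideanSpace ℝ (Fin N) × EuclideanSpace ℝ (Fin N)) =>
      hsDiff s (w p.1) p.2 * hsDiff s χ p.2) ((volume.restrict I).prod volume) :=
    (integrable_prod_hsDiff_mul hw hE hχ).mono_measure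
      (Measure.prod_mono (Measure.restrict_mono hI le_rfl) le_rfl)
  have hae : (fun q => ∫ t in I, hsDiff s (w t) q * hsDiff s χ q)
      =ᵐ[volume] fun q => hsDiff s (fun x => ∫ t in I, w t x) q * hsDiff s χ q := by
    have h0 := ae_integrableOn_time hw hE
    have h1 : ∀ᵐ q : EuclideanSpace ℝ (Fin N) × EuclideanSpace ℝ (Fin N),
        IntegrableOn (fun t => w t q.1) (Ioo 0 T) := Measure.quasiMeasurePreserving_fst.ae h0
    have h2 : ∀ᵐ q : EuclideanSpace ℝ (Fin N) × EuclideanSpace ℝ (Fin N),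
        IntegrableOn (fun t => w t q.2) (Ioo 0 T) := Measure.quasiMeasurePreserving_snd.ae h0
    filter_upwards [h1, h2] with q e1 e2
    rw [integral_mul_const]
    congr 1
    unfold hsDiff
    rw [integral_div, integral_sub (e1.mono_set hI) (e2.mono_set hI)]
  refine ⟨(hint.integral_prod_right).congr hae, ?_⟩
  simp only [hsForm_eq]
  rw [← integral_congr_ae hae]
  exact (integral_integral_swap (f := fun t q => hsDiff s (w t) q * hsDiff s χ q) hint).symm

end TimeIntegral

/-! ### The weak formulation integrated in time -/

/-- The cut-off in time that equals `1` up to `t - ε`, decreases linearly and vanishes from `t`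
on. -/
noncomputable def ramp (t ε r : ℝ) : ℝ := max 0 (min 1 ((t - r) / ε))

theorem ramp_nonneg (t ε r : ℝ) : 0 ≤ ramp t ε r := le_max_left _ _

theorem ramp_le_one (t ε r : ℝ) : ramp t ε r ≤ 1 := max_le zero_le_one (min_le_left _ _)

theorem ramp_of_le {t ε r : ℝ} (hε : 0 < ε) (h : t ≤ r) : ramp t ε r = 0 := by
  have : (t - r) / ε ≤ 0 := div_nonpos_of_nonpos_of_nonneg (by linarith) hε.le
  exact max_eq_left ((min_le_right _ _).trans this)

theorem ramp_of_le_sub {t ε r : ℝ} (hε : 0 < ε) (h : r ≤ t - ε) : ramp t ε r = 1 := by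
  have : 1 ≤ (t - r) / ε := by rw [le_div_iff₀ hε]; linarith
  rw [ramp, min_eq_left this, max_eq_right zero_le_one]

theorem abs_ramp_sub_le {t ε : ℝ} (hε : 0 < ε) (r r' : ℝ) :
    |ramp t ε r - ramp t ε r'| ≤ ε⁻¹ * |r - r'| := by
  calc |ramp t ε r - ramp t ε r'| ≤ |min 1 ((t - r) / ε) - min 1 ((t - r') / ε)| := by
        simpa [ramp] using abs_max_sub_max_le_max 0 (min 1 ((t - r) / ε)) 0 (min 1 ((t - r') / ε))
    _ ≤ |(t - r) / ε - (t - r') / ε| := by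
        simpa using abs_min_sub_min_le_max 1 ((t - r) / ε) 1 ((t - r') / ε)
    _ = ε⁻¹ * |r - r'| := by
        rw [show (t - r) / ε - (t - r') / ε = -(ε⁻¹ * (r - r')) by ring, abs_neg, abs_mul,
          abs_of_pos (inv_pos.mpr hε)]

theorem deriv_ramp {t ε r : ℝ} (hε : 0 < ε) (h1 : r ≠ t - ε) (h2 : r ≠ t) :
    deriv (ramp t ε) r = (Ioo (t - ε) t).indicator (fun _ => -ε⁻¹) r := by
  rcases lt_or_gt_of_ne h1 with h1 | h1
  · rw [indicator_of_notMem (fun h => absurd h.1 (not_lt.mpr h1.le))]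
    have : ramp t ε =ᶠ[𝓝 r] fun _ => 1 := by
      filter_upwards [Iio_mem_nhds h1] with y hy using ramp_of_le_sub hε (le_of_lt hy)
    rw [this.deriv_eq, deriv_const]
  rcases lt_or_gt_of_ne h2 with h2 | h2
  · rw [indicator_of_mem (show r ∈ Ioo (t - ε) t from ⟨h1, h2⟩)]
    have : ramp t ε =ᶠ[𝓝 r] fun y => (t - y) / ε := by
      filter_upwards [Ioo_mem_nhds h1 h2] with y hy
      have h3 : (t - y) / ε ≤ 1 := by rw [div_le_one hε]; linarith [hy.1]
      have h4 : 0 ≤ (t - y) / ε := div_nonneg (by linarith [hy.2]) hε.le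
      rw [ramp, min_eq_right h3, max_eq_right h4]
    rw [this.deriv_eq]
    have hd : HasDerivAt (fun y => (t - y) / ε) (-1 / ε) r :=
      ((hasDerivAt_id r).const_sub t).div_const ε
    rw [hd.deriv]; ring
  · rw [indicator_of_notMem (fun h => absurd h.2 (not_lt.mpr h2.le))]
    have : ramp t ε =ᶠ[𝓝 r] fun _ => 0 := by
      filter_upwards [Ioi_mem_nhds h2] with y hy using ramp_of_le hε (le_of_lt hy)
    rw [this.deriv_eq, deriv_const]

/-- Averages over shrinking left intervals converge to the value of a continuous function. -/
theorem tendsto_left_average {G : ℝ → ℝ} {T t : ℝ} (hG : ContinuousOn G (Icc 0 T)) (ht0 : 0 < t)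
    (htT : t ≤ T) :
    Tendsto (fun ε => ε⁻¹ * ∫ r in Ioo (t - ε) t, G r) (𝓝[>] 0) (𝓝 (G t)) := by
  rw [Metric.tendsto_nhds]
  intro δ hδ
  obtain ⟨ρ, hρ, h⟩ := Metric.continuousWithinAt_iff.mp (hG t ⟨ht0.le, htT⟩) (δ / 2) (by positivity)
  filter_upwards [Ioo_mem_nhdsGT (lt_min hρ ht0)] with ε hε
  have hε0 : 0 < ε := hε.1
  have hερ : ε < ρ := hε.2.trans_le (min_le_left _ _)
  have hεt : ε < t := hε.2.trans_le (min_le_right _ _)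
  have hsub : Ioo (t - ε) t ⊆ Icc 0 T := fun r hr => ⟨by linarith [hr.1], by linarith [hr.2]⟩
  have hGi : IntegrableOn G (Ioo (t - ε) t) := (hG.integrableOn_Icc).mono_set hsub
  have hvol : volume.real (Ioo (t - ε) t) = ε := by
    rw [Real.volume_real_Ioo_of_le (by linarith)]; ring
  have hc : ∫ _ in Ioo (t - ε) t, G t = ε * G t := by
    rw [setIntegral_const, hvol, smul_eq_mul]
  have hle : ‖∫ r in Ioo (t - ε) t, (G r - G t)‖ ≤ δ / 2 * volume.real (Ioo (t - ε) t) := by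
    refine norm_setIntegral_le_of_norm_le_const measure_Ioo_lt_top fun r hr => ?_
    refine (h (hsub hr) ?_).le
    rw [Real.dist_eq, abs_lt]
    constructor <;> linarith [hr.1, hr.2]
  rw [integral_sub hGi (integrable_const _), hc, hvol] at hle
  rw [Real.dist_eq]
  have e : ε⁻¹ * ∫ r in Ioo (t - ε) t, G r =
      G t + ε⁻¹ * ((∫ r in Ioo (t - ε) t, G r) - ε * G t) := by
    field_simp; ring
  rw [e, add_sub_cancel_left, abs_mul, abs_of_pos (inv_pos.mpr hε0)]
  calc _ ≤ ε⁻¹ * (δ / 2 * ε) := by gcongr; exact hle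
    _ = δ / 2 := by field_simp
    _ < δ := by linarith

section Weak

variable {Ω : Set (EuclideanSpace ℝ (Fin N))} {s m T : ℝ} {u₀ : EuclideanSpace ℝ (Fin N) → ℝ}
  {u : ℝ → EuclideanSpace ℝ (Fin N) → ℝ} {χ : EuclideanSpace ℝ (Fin N) → ℝ}

theorem IsWeakSolution.continuousOn_pairing (hu : IsWeakSolution Ω s m T u₀ u)
    (hχm : Measurable χ) {B : ℝ} (hB : ∀ x, |χ x| ≤ B) :
    ContinuousOn (fun t => ∫ x, u t x * χ x) (Icc 0 T) := by
  have hint : ∀ t ∈ Icc 0 T, Integrable fun x => u t x * χ x := fun t ht =>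
    (hu.integrable t ht).mul_bdd hχm.aestronglyMeasurable (ae_of_all _ hB)
  intro t₀ ht₀
  have h0 : Tendsto (fun t => B * (eLpNorm (u t - u t₀) 1 volume).toReal) (𝓝[Icc 0 T] t₀)
      (𝓝 0) := by
    have := ((ENNReal.tendsto_toReal ENNReal.zero_ne_top).comp
      (hu.continuous_L1 t₀ ht₀)).const_mul B
    simpa using this
  rw [ContinuousWithinAt, tendsto_iff_norm_sub_tendsto_zero]
  refine squeeze_zero' (Eventually.of_forall fun t => norm_nonneg _) ?_ h0
  filter_upwards [self_mem_nhdsWithin] with t ht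
  have hd : Integrable (u t - u t₀) := (hu.integrable t ht).sub (hu.integrable t₀ ht₀)
  rw [← integral_sub (hint t ht) (hint t₀ ht₀), eLpNorm_one_eq_lintegral_enorm,
    ← integral_norm_eq_lintegral_enorm hd.aestronglyMeasurable, ← integral_const_mul]
  refine norm_integral_le_of_norm_le (hd.norm.const_mul B) (ae_of_all _ fun x => ?_)
  rw [← sub_mul, norm_mul, mul_comm]
  exact mul_le_mul_of_nonneg_right (hB x) (norm_nonneg _)

/-- The weak formulation tested with a function of `x` alone, up to time `t`; it follows by testing
with `ramp t ε r * χ x` and letting `ε → 0`. -/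
theorem IsWeakSolution.integral_mul_add (hu : IsWeakSolution Ω s m T u₀ u) {L : ℝ≥0}
    (hL : LipschitzWith L χ) {B : ℝ} (hB : ∀ x, |χ x| ≤ B) (hχ0 : ∀ x, x ∉ Ω → χ x = 0)
    (hA : IntegrableOn (fun t => hsForm s (fun x => spow m (u t x)) χ) (Ioo 0 T))
    {t : ℝ} (ht0 : 0 < t) (htT : t ≤ T) :
    (∫ x, u t x * χ x) + ∫ r in Ioo 0 t, hsForm s (fun x => spow m (u r x)) χ
      = ∫ x, u₀ x * χ x := by
  set G : ℝ → ℝ := fun r => ∫ x, u r x * χ x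
  set A : ℝ → ℝ := fun r => hsForm s (fun x => spow m (u r x)) χ
  have hB0 : 0 ≤ B := (abs_nonneg _).trans (hB 0)
  have hG : ContinuousOn G (Icc 0 T) := hu.continuousOn_pairing hL.continuous.measurable hB
  have hid : ∀ ε, 0 < ε → ε < t → ε⁻¹ * (∫ r in Ioo (t - ε) t, G r)
      + ∫ r in Ioo 0 T, ramp t ε r * A r = ∫ x, u₀ x * χ x := by
    intro ε hε hεt
    have htest : IsTestFunction Ω T fun r x => ramp t ε r * χ x := by
      refine ⟨⟨ε⁻¹.toNNReal * B.toNNReal + L, LipschitzWith.of_dist_le_mul ?_⟩,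
        fun r x hx => by simp [hχ0 x hx], fun x => by simp [ramp_of_le hε htT]⟩
      rintro ⟨r, x⟩ ⟨r', x'⟩
      simp only [Function.uncurry, Prod.dist_eq, NNReal.coe_add, NNReal.coe_mul,
        Real.coe_toNNReal _ (inv_pos.mpr hε).le, Real.coe_toNNReal _ hB0]
      have h1 : |ramp t ε r - ramp t ε r'| ≤ ε⁻¹ * max (dist r r') (dist x x') :=
        (abs_ramp_sub_le hε r r').trans (by gcongr; exact le_max_left _ _)
      have h2 : |χ x - χ x'| ≤ L * max (dist r r') (dist x x') := by
        rw [← Real.dist_eq]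
        exact (hL.dist_le_mul x x').trans (by gcongr; exact le_max_right _ _)
      have h3 : |ramp t ε r'| ≤ 1 := by
        rw [abs_of_nonneg (ramp_nonneg _ _ _)]; exact ramp_le_one _ _ _
      rw [Real.dist_eq, show ramp t ε r * χ x - ramp t ε r' * χ x' =
        (ramp t ε r - ramp t ε r') * χ x + ramp t ε r' * (χ x - χ x') by ring]
      calc _ ≤ |ramp t ε r - ramp t ε r'| * |χ x| + |ramp t ε r'| * |χ x - χ x'| := by
            rw [← abs_mul, ← abs_mul]; exact abs_add_le _ _
        _ ≤ (ε⁻¹ * max (dist r r') (dist x x')) * B + 1 * (L * max (dist r r') (dist x x')) := by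
            gcongr
            exact hB x
        _ = _ := by ring
    have h := hu.weak_eq _ htest
    have e1 : ∫ r in Ioo 0 T, ∫ x, u r x * deriv (fun ρ => ramp t ε ρ * χ x) r
        = -(ε⁻¹ * ∫ r in Ioo (t - ε) t, G r) := by
      have hsub : Ioo (t - ε) t ⊆ Ioo 0 T := Ioo_subset_Ioo (by linarith) htT
      have hne : ∀ a : ℝ, ∀ᵐ r ∂volume.restrict (Ioo 0 T), r ≠ a := fun a =>
        ae_restrict_of_ae (by simp [ae_iff, measure_singleton])
      have : (fun r => ∫ x, u r x * deriv (fun ρ => ramp t ε ρ * χ x) r)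
          =ᵐ[volume.restrict (Ioo 0 T)] (Ioo (t - ε) t).indicator fun r => -ε⁻¹ * G r := by
        filter_upwards [hne (t - ε), hne t] with r hr1 hr2
        simp only [deriv_mul_const_field, deriv_ramp hε hr1 hr2]
        by_cases hr : r ∈ Ioo (t - ε) t
        · simp only [indicator_of_mem hr, G]
          rw [← integral_const_mul]
          exact integral_congr_ae (ae_of_all _ fun x => by ring)
        · simp [indicator_of_notMem hr]
      rw [integral_congr_ae this, setIntegral_indicator measurableSet_Ioo,
        inter_eq_right.mpr hsub, integral_const_mul, neg_mul]
    have e2 : ∀ r, hsForm s (fun x => spow m (u r x)) (fun x => ramp t ε r * χ x)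
        = ramp t ε r * A r := fun r => by
      rw [hsForm_comm]
      exact (hsForm_smul_left s _ χ _).trans (by rw [hsForm_comm])
    have e3 : ramp t ε 0 = 1 := ramp_of_le_sub hε (by linarith)
    rw [e1, neg_neg] at h
    simpa only [e2, e3, one_mul] using h
  have hlim1 := tendsto_left_average hG ht0 htT
  have hlim2 : Tendsto (fun ε => ∫ r in Ioo 0 T, ramp t ε r * A r) (𝓝[>] 0)
      (𝓝 (∫ r in Ioo 0 T, (Iio t).indicator A r)) := by
    refine tendsto_integral_filter_of_dominated_convergence (fun r => ‖A r‖) ?_ ?_ hA.norm ?_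
    · refine Eventually.of_forall fun ε => ?_
      have : Measurable (ramp t ε) := by unfold ramp; fun_prop
      exact this.aestronglyMeasurable.mul hA.aestronglyMeasurable
    · refine Eventually.of_forall fun ε => ae_of_all _ fun r => ?_
      rw [norm_mul, Real.norm_of_nonneg (ramp_nonneg _ _ _)]
      exact mul_le_of_le_one_left (norm_nonneg _) (ramp_le_one _ _ _)
    · refine ae_of_all _ fun r => ?_
      refine tendsto_const_nhds.congr' ?_
      rcases lt_or_ge r t with hr | hr
      · filter_upwards [Ioo_mem_nhdsGT (sub_pos.mpr hr)] with ε hε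
        rw [indicator_of_mem (show r ∈ Iio t from hr),
          ramp_of_le_sub hε.1 (by linarith [hε.2]), one_mul]
      · filter_upwards [self_mem_nhdsWithin] with ε hε
        rw [indicator_of_notMem (show r ∉ Iio t from not_lt.mpr hr), ramp_of_le hε hr, zero_mul]
  have hind : ∫ r in Ioo 0 T, (Iio t).indicator A r = ∫ r in Ioo 0 t, A r := by
    rw [setIntegral_indicator measurableSet_Iio]
    congr 2
    ext r
    simp only [mem_inter_iff, mem_Ioo, mem_Iio]
    exact ⟨fun h => ⟨h.1.1, h.2⟩, fun h => ⟨⟨h.1, h.2.trans_le htT⟩, h.2⟩⟩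
  rw [hind] at hlim2
  refine tendsto_nhds_unique (hlim1.add hlim2) (tendsto_const_nhds.congr' ?_)
  filter_upwards [Ioo_mem_nhdsGT ht0] with ε hε using (hid ε hε.1 hε.2).symm

/-- The weak solution attains its initial value, in the sense needed to compare with the discrete
scheme. -/
theorem IsWeakSolution.integral_mul_initial (hu : IsWeakSolution Ω s m T u₀ u) (hT : 0 < T)
    {L : ℝ≥0} (hL : LipschitzWith L χ) {B : ℝ} (hB : ∀ x, |χ x| ≤ B) (hχ0 : ∀ x, x ∉ Ω → χ x = 0)
    (hA : IntegrableOn (fun t => hsForm s (fun x => spow m (u t x)) χ) (Ioo 0 T)) :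
    ∫ x, u 0 x * χ x = ∫ x, u₀ x * χ x := by
  have h0 : (0 : ℝ) ∈ Icc 0 T := ⟨le_rfl, hT.le⟩
  have hle : 𝓝[Ioc 0 T] (0 : ℝ) ≤ 𝓝[Icc 0 T] 0 := nhdsWithin_mono _ Ioc_subset_Icc_self
  have hG := (hu.continuousOn_pairing hL.continuous.measurable hB 0 h0).tendsto.mono_left hle
  have hA' : IntegrableOn (fun t => hsForm s (fun x => spow m (u t x)) χ) (Icc 0 T) :=
    (integrableOn_Icc_iff_integrableOn_Ioo).mpr hA
  have hP := (intervalIntegral.continuousOn_primitive hA' 0 h0).tendsto.mono_left hle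
  have hne : (𝓝[Ioc 0 T] (0 : ℝ)).NeBot := by
    rw [nhdsWithin_Ioc_eq_nhdsGT hT]; infer_instance
  have hsum := hG.add hP
  simp only [Ioc_self, Measure.restrict_empty, integral_zero_measure, add_zero] at hsum
  refine tendsto_nhds_unique hsum (tendsto_const_nhds.congr' ?_)
  filter_upwards [self_mem_nhdsWithin] with t ht
  rw [integral_Ioc_eq_integral_Ioo]
  exact (hu.integral_mul_add hL hB hχ0 hA ht.1 ht.2).symm

end Weak

/-! ### The discrete energy argument -/

/-- Summation by parts for the error equation `e (n+1) - e n + B (δ n) = 0`, tested with `δ n`: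
the form contributes at least half of the energy of `∑ δ n`. -/
theorem sum_add_half_le {V : Type*} [AddCommGroup V] [Module ℝ V] (B : LinearMap.BilinForm ℝ V)
    (hsymm : ∀ x y, B x y = B y x) (hnonneg : ∀ x, 0 ≤ B x x) (e : ℕ → V → ℝ)
    (h0 : ∀ x y, e 0 (x + y) = e 0 x + e 0 y) (δ : ℕ → V) (M : ℕ)
    (h : ∀ n < M, ∀ χ, e (n + 1) χ - e n χ + B (δ n) χ = 0) :
    (∑ n ∈ Finset.range M, e (n + 1) (δ n))
      + 1 / 2 * B (∑ n ∈ Finset.range M, δ n) (∑ n ∈ Finset.range M, δ n)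
      ≤ e 0 (∑ n ∈ Finset.range M, δ n) := by
  have hacc : ∀ n ≤ M, ∀ χ, e n χ = e 0 χ - B (∑ j ∈ Finset.range n, δ j) χ := by
    intro n
    induction n with
    | zero => intro _ χ; simp
    | succ n ih =>
      intro hn χ
      have h1 := h n hn χ
      have h2 := ih (by omega) χ
      rw [Finset.sum_range_succ, map_add, LinearMap.add_apply]
      linarith
  suffices hk : ∀ k ≤ M, (∑ n ∈ Finset.range k, e (n + 1) (δ n))
      + 1 / 2 * B (∑ n ∈ Finset.range k, δ n) (∑ n ∈ Finset.range k, δ n)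
      ≤ e 0 (∑ n ∈ Finset.range k, δ n) from hk M le_rfl
  intro k
  induction k with
  | zero =>
    intro _
    have : e 0 0 = 0 := by simpa using h0 0 0
    simp [this]
  | succ k ih =>
    intro hk
    have h1 := ih (by omega)
    have h2 := hacc (k + 1) hk (δ k)
    rw [Finset.sum_range_succ] at h2
    rw [Finset.sum_range_succ, Finset.sum_range_succ, h0]
    set D := ∑ n ∈ Finset.range k, δ n
    have h3 := hsymm (δ k) D
    have h4 := hnonneg (δ k)
    simp only [map_add, LinearMap.add_apply] at h2 ⊢
    linarith

theorem restrict_Ioo_eq_sum {τ : ℝ} (hτ : 0 < τ) (M : ℕ) :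
    (volume : Measure ℝ).restrict (Ioo 0 (M * τ))
      = ∑ n ∈ Finset.range M, volume.restrict (Ioo ((n : ℝ) * τ) ((n + 1) * τ)) := by
  simp only [restrict_Ioo_eq_restrict_Ioc]
  induction M with
  | zero => simp
  | succ M ih =>
    rw [Finset.sum_range_succ, ← ih, ← Measure.restrict_union ?_ measurableSet_Ioc,
      Ioc_union_Ioc_eq_Ioc (by positivity) (by gcongr; linarith)]
    · push_cast; rfl
    · rw [Set.disjoint_left]
      exact fun x hx hx' => absurd hx.2 (not_le.mpr hx'.1)

theorem sum_Icc_one_eq_sum_range {α : Type*} [AddCommMonoid α] (f : ℕ → α) (M : ℕ) :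
    ∑ n ∈ Finset.Icc 1 M, f n = ∑ n ∈ Finset.range M, f (n + 1) := by
  rw [Finset.range_eq_Ico, Finset.sum_Ico_add' f 0 M 1]
  rfl

theorem discreteFun_of_mem {τ : ℝ} (hτ : 0 < τ) (W : ℕ → EuclideanSpace ℝ (Fin N) → ℝ) {n : ℕ}
    {t : ℝ} (ht : t ∈ Ioo ((n : ℝ) * τ) ((n + 1) * τ)) : discreteFun τ W t = W (n + 1) := by
  have : ⌈t / τ⌉₊ = n + 1 := by
    rw [Nat.ceil_eq_iff (by omega)]
    constructor
    · rw [lt_div_iff₀ hτ]; simpa using ht.1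
    · rw [div_le_iff₀ hτ]; simpa using ht.2.le
  rw [discreteFun, this]

theorem timeAvg_succ (τ : ℝ) (w : ℝ → EuclideanSpace ℝ (Fin N) → ℝ) (n : ℕ) :
    timeAvg τ w (n + 1) = τ⁻¹ • fun x => ∫ t in Ioo ((n : ℝ) * τ) ((n + 1) * τ), w t x := by
  funext x
  simp [timeAvg]

/-- A lower bound for the integral of `F`, when the error terms `q₂`, `q₃` have finite integrals. -/
theorem mul_toReal_lintegral_le {α : Type*} [MeasurableSpace α] {μ : Measure α}
    {F q₁ q₂ q₃ : α → ℝ} {c C : ℝ} (hc : 0 < c) (hF : Integrable F μ) (h0 : ∀ x, 0 ≤ q₁ x)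
    (h0₂ : ∀ x, 0 ≤ q₂ x) (h0₃ : ∀ x, 0 ≤ q₃ x) (hm₁ : Measurable q₁)
    (hm₂ : Measurable q₂) (hm₃ : Measurable q₃)
    (h : ∀ x, c * q₁ x ≤ F x + C * q₂ x + C * q₃ x)
    (h₂ : ∫⁻ x, ENNReal.ofReal (q₂ x) ∂μ < ∞) (h₃ : ∫⁻ x, ENNReal.ofReal (q₃ x) ∂μ < ∞) :
    ∫⁻ x, ENNReal.ofReal (q₁ x) ∂μ < ∞ ∧
      c * (∫⁻ x, ENNReal.ofReal (q₁ x) ∂μ).toReal ≤ (∫ x, F x ∂μ)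
        + C * (∫⁻ x, ENNReal.ofReal (q₂ x) ∂μ).toReal
        + C * (∫⁻ x, ENNReal.ofReal (q₃ x) ∂μ).toReal := by
  have i₂ : Integrable q₂ μ := ⟨hm₂.aestronglyMeasurable, by
    rwa [hasFiniteIntegral_iff_ofReal (ae_of_all _ h0₂)]⟩
  have i₃ : Integrable q₃ μ := ⟨hm₃.aestronglyMeasurable, by
    rwa [hasFiniteIntegral_iff_ofReal (ae_of_all _ h0₃)]⟩
  have iF : Integrable (fun x => F x + C * q₂ x) μ := hF.add (i₂.const_mul C)
  have iR : Integrable (fun x => F x + C * q₂ x + C * q₃ x) μ := iF.add (i₃.const_mul C)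
  have i₁ : Integrable q₁ μ := by
    refine (iR.const_mul c⁻¹).mono' hm₁.aestronglyMeasurable (ae_of_all _ fun x => ?_)
    rw [Real.norm_of_nonneg (h0 x), inv_mul_eq_div, le_div_iff₀ hc, mul_comm]
    exact h x
  have e : ∀ q : α → ℝ, Measurable q → (∀ x, 0 ≤ q x) →
      (∫⁻ x, ENNReal.ofReal (q x) ∂μ).toReal = ∫ x, q x ∂μ := fun q hq hq0 =>
    (integral_eq_lintegral_of_nonneg_ae (ae_of_all _ hq0) hq.aestronglyMeasurable).symm
  refine ⟨by rw [← ofReal_integral_eq_lintegral_ofReal i₁ (ae_of_all _ h0)]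
             exact ENNReal.ofReal_lt_top, ?_⟩
  rw [e _ hm₁ h0, e _ hm₂ h0₂, e _ hm₃ h0₃, ← integral_const_mul, ← integral_const_mul,
    ← integral_const_mul, ← integral_add hF (i₂.const_mul C),
    ← integral_add iF (i₃.const_mul C)]
  exact integral_mono (i₁.const_mul c) iR h

section

variable {Ω : Set (EuclideanSpace ℝ (Fin N))} {κ : ℝ}
  {𝒯 : Geometry.SimplicialComplex ℝ (EuclideanSpace ℝ (Fin N))}

theorem lintegral_quasiNormSq (I : Set ℝ) (p : ℝ) {w v : ℝ → EuclideanSpace ℝ (Fin N) → ℝ}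
    (hw : Measurable (Function.uncurry w)) (hv : Measurable (Function.uncurry v)) :
    ∫⁻ t in I, quasiNormSq Ω p (w t) (v t)
      = ∫⁻ z, ENNReal.ofReal (quasiIntegrand p (w z.1 z.2) (v z.1 z.2))
        ∂((volume.restrict I).prod (volume.restrict Ω)) := by
  have hm : Measurable fun z : ℝ × EuclideanSpace ℝ (Fin N) =>
      ENNReal.ofReal (quasiIntegrand p (w z.1 z.2) (v z.1 z.2)) :=
    ((measurable_quasiIntegrand p).comp (hw.prodMk hv)).ennreal_ofReal
  rw [lintegral_prod _ hm.aemeasurable]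
  rfl

/-- The contribution of one time step. The functions `d i`, `coeff i` are the coordinates of
`P_h w(t)`, `d₀` is `w` at the end of the step, and the integral on the right is the pairing of the
error at the end of the step with the increment used as a test function. It converges although
`ψ(d₀)` is only integrable, because finite element functions are bounded. -/
theorem mul_toReal_lintegral_quasiNormSq_le (hb : Bornology.IsBounded Ω)
    {m : ℝ} (hm : 0 < m) {c C : ℝ} (hc : 0 < c)
    (hpt : ∀ a b p d : ℝ,
      c * quasiIntegrand ((m + 1) / m) a (a - b) ≤ (psi m d - psi m b) * (p - b)
        + C * quasiIntegrand ((m + 1) / m) a (a - p)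
        + C * quasiIntegrand ((m + 1) / m) a (d - a))
    {I : Set ℝ} (hI : volume I < ∞) {k : ℕ} {coeff : Fin k → ℝ → ℝ}
    (hcm : ∀ i, Measurable (coeff i)) (hci : ∀ i, IntegrableOn (coeff i) I)
    {d : Fin k → EuclideanSpace ℝ (Fin N) → ℝ} (hd : ∀ i, d i ∈ feSpace Ω 𝒯)
    {w : ℝ → EuclideanSpace ℝ (Fin N) → ℝ} (hw : Measurable (Function.uncurry w))
    {d₀ W : EuclideanSpace ℝ (Fin N) → ℝ} (hd₀m : Measurable d₀)
    (hd₀ : Integrable fun x => psi m (d₀ x)) (hW : W ∈ feSpace Ω 𝒯)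
    (h₂ : ∫⁻ t in I, quasiNormSq Ω ((m + 1) / m) (w t)
      (fun x => w t x - ∑ i, coeff i t * d i x) < ∞)
    (h₃ : ∫⁻ t in I, quasiNormSq Ω ((m + 1) / m) (w t) (fun x => d₀ x - w t x) < ∞) :
    ∫⁻ t in I, quasiNormSq Ω ((m + 1) / m) (w t) (fun x => w t x - W x) < ∞ ∧
      c * (∫⁻ t in I, quasiNormSq Ω ((m + 1) / m) (w t) (fun x => w t x - W x)).toReal
      ≤ (∫ x, (psi m (d₀ x) - psi m (W x)) *
          ((∑ i, (∫ t in I, coeff i t) * d i x) - volume.real I * W x))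
        + C * (∫⁻ t in I, quasiNormSq Ω ((m + 1) / m) (w t)
          (fun x => w t x - ∑ i, coeff i t * d i x)).toReal
        + C * (∫⁻ t in I, quasiNormSq Ω ((m + 1) / m) (w t) (fun x => d₀ x - w t x)).toReal := by
  have hIf : IsFiniteMeasure (volume.restrict I) := ⟨by simpa using hI⟩
  have hWm : Measurable W := hW.1.measurable
  have hdm : ∀ i, Measurable (d i) := fun i => (hd i).1.measurable
  have hv₁ : Measurable (Function.uncurry fun t x => w t x - W x) :=
    hw.sub (hWm.comp measurable_snd)
  have hv₂ : Measurable (Function.uncurry fun t x => w t x - ∑ i, coeff i t * d i x) := by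
    refine hw.sub (Finset.measurable_sum _ fun i _ => ?_)
    exact ((hcm i).comp measurable_fst).mul ((hdm i).comp measurable_snd)
  have hv₃ : Measurable (Function.uncurry fun t x => d₀ x - w t x) :=
    (hd₀m.comp measurable_snd).sub hw
  rw [lintegral_quasiNormSq I _ hw hv₁, lintegral_quasiNormSq I _ hw hv₂,
    lintegral_quasiNormSq I _ hw hv₃]
  rw [lintegral_quasiNormSq I _ hw hv₂] at h₂
  rw [lintegral_quasiNormSq I _ hw hv₃] at h₃
  set g : EuclideanSpace ℝ (Fin N) → ℝ := fun x => psi m (d₀ x) - psi m (W x)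
  have hg : Integrable g := hd₀.sub (integrable_psi_of_mem_feSpace hb hm hW)
  have hgd : ∀ φ ∈ feSpace Ω 𝒯, Integrable (fun x => g x * φ x) (volume.restrict Ω) :=
    fun φ hφ => (integrable_mul_of_mem_feSpace hb hg hφ).restrict
  have hset : ∀ φ ∈ feSpace Ω 𝒯, ∫ x in Ω, g x * φ x = ∫ x, g x * φ x := fun φ hφ =>
    setIntegral_eq_integral_of_forall_compl_eq_zero fun x hx => by rw [hφ.2.2 x hx, mul_zero]
  set ν := (volume.restrict I).prod (volume.restrict Ω)
  have eF : (fun z : ℝ × EuclideanSpace ℝ (Fin N) =>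
      g z.2 * ((∑ i, coeff i z.1 * d i z.2) - W z.2))
      = fun z => (∑ i, coeff i z.1 * (g z.2 * d i z.2)) - (1 : ℝ) * (g z.2 * W z.2) := by
    funext z
    rw [mul_sub, Finset.mul_sum, one_mul]
    congr 1
    exact Finset.sum_congr rfl fun i _ => by ring
  have i1 : ∀ i, Integrable (fun z : ℝ × EuclideanSpace ℝ (Fin N) =>
      coeff i z.1 * (g z.2 * d i z.2)) ν := fun i => (hci i).mul_prod (hgd _ (hd i))
  have i2 : Integrable (fun z : ℝ × EuclideanSpace ℝ (Fin N) =>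
      (1 : ℝ) * (g z.2 * W z.2)) ν := (integrable_const (1 : ℝ)).mul_prod (hgd _ hW)
  have hF : Integrable (fun z : ℝ × EuclideanSpace ℝ (Fin N) =>
      g z.2 * ((∑ i, coeff i z.1 * d i z.2) - W z.2)) ν := by
    rw [eF]
    exact (integrable_finsetSum _ fun i _ => i1 i).sub i2
  have hFint : ∫ z, g z.2 * ((∑ i, coeff i z.1 * d i z.2) - W z.2) ∂ν
      = ∫ x, g x * ((∑ i, (∫ t in I, coeff i t) * d i x) - volume.real I * W x) := by
    rw [eF, integral_sub (integrable_finsetSum _ fun i _ => i1 i) i2,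
      integral_finsetSum _ fun i _ => i1 i]
    have e1 : ∀ i, ∫ z, coeff i z.1 * (g z.2 * d i z.2) ∂ν
        = (∫ t in I, coeff i t) * ∫ x, g x * d i x := fun i => by
      rw [← hset _ (hd i)]
      exact integral_prod_mul (coeff i) (fun x => g x * d i x)
    have e2 : ∫ z, (1 : ℝ) * (g z.2 * W z.2) ∂ν = volume.real I * ∫ x, g x * W x := by
      rw [← hset _ hW]
      have := integral_prod_mul (μ := volume.restrict I) (ν := volume.restrict Ω)
        (fun _ : ℝ => (1 : ℝ)) (fun x => g x * W x)
      rw [this]; simp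
    simp only [e1, e2]
    have e3 : (fun x => g x * ((∑ i, (∫ t in I, coeff i t) * d i x) - volume.real I * W x))
        = fun x => (∑ i, (∫ t in I, coeff i t) * (g x * d i x)) - volume.real I * (g x * W x) := by
      funext x
      rw [mul_sub, Finset.mul_sum]
      congr 1
      · exact Finset.sum_congr rfl fun i _ => by ring
      · ring
    have j1 : ∀ i, Integrable fun x => (∫ t in I, coeff i t) * (g x * d i x) := fun i =>
      (integrable_mul_of_mem_feSpace hb hg (hd i)).const_mul _
    have j2 : Integrable fun x => volume.real I * (g x * W x) :=
      (integrable_mul_of_mem_feSpace hb hg hW).const_mul _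
    rw [e3, integral_sub (integrable_finsetSum _ fun i _ => j1 i) j2,
      integral_finsetSum _ fun i _ => j1 i]
    simp only [integral_const_mul]
  rw [← hFint]
  exact mul_toReal_lintegral_le hc hF (fun z => quasiIntegrand_nonneg _ _ _)
    (fun z => quasiIntegrand_nonneg _ _ _) (fun z => quasiIntegrand_nonneg _ _ _)
    ((measurable_quasiIntegrand _).comp (hw.prodMk hv₁))
    ((measurable_quasiIntegrand _).comp (hw.prodMk hv₂))
    ((measurable_quasiIntegrand _).comp (hw.prodMk hv₃))
    (fun z => hpt (w z.1 z.2) (W z.2) (∑ i, coeff i z.1 * d i z.2) (d₀ z.2)) h₂ h₃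

/-- The initial error paired with a finite element function. -/
theorem integral_mul_le_of_poincare (hb : Bornology.IsBounded Ω) {s C : ℝ} (hC : 0 < C)
    (hP : ∀ v : EuclideanSpace ℝ (Fin N) → ℝ, Measurable v → (∀ x, x ∉ Ω → v x = 0) →
      ∫⁻ x, ENNReal.ofReal (v x ^ 2) ≤ ENNReal.ofReal C * hsSeminormSq s v)
    {g φ : EuclideanSpace ℝ (Fin N) → ℝ} (hg : Integrable g) (hg2 : eLpNorm g 2 volume < ∞)
    (hφ : φ ∈ feSpace Ω 𝒯) (hφs : MemLp (hsDiff s φ) 2) :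
    ∫ x, g x * φ x ≤ C * (eLpNorm g 2 volume ^ 2).toReal + 1 / 4 * hsForm s φ φ := by
  have hgL : MemLp g 2 := ⟨hg.aestronglyMeasurable, hg2⟩
  have hsq : ∫ x, g x ^ 2 = (eLpNorm g 2 volume ^ 2).toReal := by
    have h1 := eLpNorm_nnreal_pow_eq_lintegral (f := g) (p := 2) (μ := volume) two_ne_zero
    norm_num at h1
    rw [h1, integral_eq_lintegral_of_nonneg_ae (ae_of_all _ fun x => sq_nonneg _)
      (hg.aestronglyMeasurable.pow 2)]
    congr 1
    refine lintegral_congr fun x => ?_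
    rw [Real.enorm_eq_ofReal_abs, ← ENNReal.ofReal_pow (abs_nonneg _), sq_abs]
  have hφi : Integrable fun x => φ x ^ 2 := by
    simpa only [sq] using integrable_mul_of_mem_feSpace hb (integrable_of_mem_feSpace hb hφ) hφ
  have hφ2 : ∫ x, φ x ^ 2 ≤ C * hsForm s φ φ := by
    have h1 := hP φ hφ.1.measurable hφ.2.2
    rw [← ofReal_hsForm_self hφs, ← ENNReal.ofReal_mul hC.le,
      ← ofReal_integral_eq_lintegral_ofReal hφi (ae_of_all _ fun x => sq_nonneg _)] at h1
    exact (ENNReal.ofReal_le_ofReal_iff (mul_nonneg hC.le (hsForm_self_nonneg s φ))).mp h1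
  calc ∫ x, g x * φ x ≤ ∫ x, (C * g x ^ 2 + (4 * C)⁻¹ * φ x ^ 2) := by
        refine integral_mono (integrable_mul_of_mem_feSpace hb hg hφ)
          ((hgL.integrable_sq.const_mul C).add (hφi.const_mul _)) fun x => ?_
        have : C * g x ^ 2 + (4 * C)⁻¹ * φ x ^ 2 - g x * φ x
            = C * (g x - (2 * C)⁻¹ * φ x) ^ 2 := by field_simp; ring
        have h2 : 0 ≤ C * (g x - (2 * C)⁻¹ * φ x) ^ 2 := by positivity
        linarith
    _ = C * (eLpNorm g 2 volume ^ 2).toReal + (4 * C)⁻¹ * ∫ x, φ x ^ 2 := by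
        rw [integral_add (hgL.integrable_sq.const_mul C) (hφi.const_mul _), integral_const_mul,
          integral_const_mul, hsq]
    _ ≤ C * (eLpNorm g 2 volume ^ 2).toReal + (4 * C)⁻¹ * (C * hsForm s φ φ) := by gcongr
    _ = _ := by field_simp

end

section

variable {Ω : Set (EuclideanSpace ℝ (Fin N))} {κ s m T τ : ℝ} {M : ℕ}
  {𝒯 : Geometry.SimplicialComplex ℝ (EuclideanSpace ℝ (Fin N))}
  {u₀ : EuclideanSpace ℝ (Fin N) → ℝ} {u : ℝ → EuclideanSpace ℝ (Fin N) → ℝ}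
  {W : ℕ → EuclideanSpace ℝ (Fin N) → ℝ}

theorem IsWeakSolution.measurable_spow (hu : IsWeakSolution Ω s m T u₀ u) :
    Measurable (Function.uncurry fun t x => spow m (u t x)) :=
  (FracDiffusion.measurable_spow m).comp hu.measurable

theorem IsDiscreteSolution.integrable_psi {w₀ : EuclideanSpace ℝ (Fin N) → ℝ} (hm : 0 < m)
    (hb : Bornology.IsBounded Ω) (hW : IsDiscreteSolution Ω 𝒯 s m τ M w₀ W) {n : ℕ} (hn : n ≤ M) :
    Integrable fun x => psi m (W n x) := by
  rcases n with _ | n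
  · rw [hW.initial]
    simp only [psi_spow hm]
    exact integrable_of_mem_feSpace hb (interp_mem_feSpace _)
  · exact integrable_psi_of_mem_feSpace hb hm (hW.mem n hn)

theorem Ioo_step_subset (hτ : 0 < τ) (hMT : M * τ = T) {n : ℕ} (hn : n < M) :
    Ioo ((n : ℝ) * τ) ((n + 1) * τ) ⊆ Ioo 0 T := by
  have h1 : ((n : ℝ) + 1) * τ ≤ M * τ := by
    gcongr; exact_mod_cast hn
  exact Ioo_subset_Ioo (by positivity) (by linarith)

/-- The weak formulation over one time step. -/
theorem IsWeakSolution.step (hN : 1 ≤ N) (hs0 : 0 < s) (hs1 : s < 1) (hΩ : IsOpen Ω)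
    (hb : Bornology.IsBounded Ω) (h𝒯 : IsTriangulation Ω κ 𝒯) (hu : IsWeakSolution Ω s m T u₀ u)
    (hT : 0 < T) (hτ : 0 < τ) (hMT : M * τ = T) {n : ℕ} (hn : n < M)
    {χ : EuclideanSpace ℝ (Fin N) → ℝ} (hχ : χ ∈ feSpace Ω 𝒯) :
    (∫ x, u ((n + 1) * τ) x * χ x) - (∫ x, u (n * τ) x * χ x)
      + ∫ t in Ioo ((n : ℝ) * τ) ((n + 1) * τ), hsForm s (fun x => spow m (u t x)) χ = 0 := by
  obtain ⟨L, hL⟩ := exists_lipschitzWith_of_mem_feSpace hΩ h𝒯 hχ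
  obtain ⟨B, hB⟩ := exists_bound_of_mem_feSpace hb hχ
  have hA := integrableOn_hsForm hu.measurable_spow hu.energy
    (memLp_hsDiff_of_mem_feSpace hN hs0 hs1 hΩ hb h𝒯 hχ)
  have key : ∀ k ≤ M, (∫ x, u (k * τ) x * χ x)
      + ∫ t in Ioo 0 ((k : ℝ) * τ), hsForm s (fun x => spow m (u t x)) χ
      = ∫ x, u₀ x * χ x := by
    intro k hk
    rcases Nat.eq_zero_or_pos k with rfl | hk0
    · simpa using hu.integral_mul_initial hT hL hB hχ.2.2 hA
    · have h1 : (k : ℝ) * τ ≤ M * τ := by gcongr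
      exact hu.integral_mul_add hL hB hχ.2.2 hA (by positivity) (by linarith)
  have h1 := key n hn.le
  have h2 := key (n + 1) hn
  have hI : ∀ k ≤ M, ∀ j < k, IntegrableOn (fun t => hsForm s (fun x => spow m (u t x)) χ)
      (Ioo ((j : ℝ) * τ) ((j + 1) * τ)) := fun k hk j hj =>
    hA.mono_set (Ioo_step_subset hτ hMT (hj.trans_le hk))
  rw [restrict_Ioo_eq_sum hτ, integral_finsetSum_measure fun j hj =>
    hI n hn.le j (Finset.mem_range.mp hj)] at h1
  rw [restrict_Ioo_eq_sum hτ, integral_finsetSum_measure fun j hj =>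
    hI (n + 1) hn j (Finset.mem_range.mp hj), Finset.sum_range_succ] at h2
  push_cast at h2
  linarith

/-- The error equation: the difference of the weak formulation and the discrete scheme over one time
step, with the exact flux replaced by its projection onto `S_h`. -/
theorem error_equation (hN : 1 ≤ N) (hs0 : 0 < s) (hs1 : s < 1) (hm : 0 < m) (hΩ : IsOpen Ω)
    (hb : Bornology.IsBounded Ω) (h𝒯 : IsTriangulation Ω κ 𝒯) (hu : IsWeakSolution Ω s m T u₀ u)
    (hT : 0 < T) (hτ : 0 < τ) (hMT : M * τ = T) {w₀ : EuclideanSpace ℝ (Fin N) → ℝ}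
    (hW : IsDiscreteSolution Ω 𝒯 s m τ M w₀ W) {n : ℕ} (hn : n < M)
    {p : EuclideanSpace ℝ (Fin N) → ℝ} (hp : p ∈ feSpace Ω 𝒯)
    (hform : ∀ χ ∈ feSpace Ω 𝒯, hsForm s p χ
      = ∫ t in Ioo ((n : ℝ) * τ) ((n + 1) * τ), hsForm s (fun x => spow m (u t x)) χ)
    {χ : EuclideanSpace ℝ (Fin N) → ℝ} (hχ : χ ∈ feSpace Ω 𝒯) :
    (∫ x, (u ((n + 1) * τ) x - psi m (W (n + 1) x)) * χ x)
      - (∫ x, (u (n * τ) x - psi m (W n x)) * χ x) + hsForm s (p - τ • W (n + 1)) χ = 0 := by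
  have hfe : ∀ φ ∈ feSpace Ω 𝒯, MemLp (hsDiff s φ) 2 := fun φ hφ =>
    memLp_hsDiff_of_mem_feSpace hN hs0 hs1 hΩ hb h𝒯 hφ
  have hWn : W (n + 1) ∈ feSpace Ω 𝒯 := hW.mem n hn
  have hu' : ∀ k ≤ M, Integrable fun x => u (k * τ) x * χ x := fun k hk => by
    have h1 : (k : ℝ) * τ ≤ M * τ := by gcongr
    exact integrable_mul_of_mem_feSpace hb (hu.integrable _ ⟨by positivity, by linarith⟩) hχ
  have hψ : ∀ k ≤ M, Integrable fun x => psi m (W k x) * χ x := fun k hk =>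
    integrable_mul_of_mem_feSpace hb (hW.integrable_psi hm hb hk) hχ
  have hsplit : ∀ k ≤ M, ∫ x, (u (k * τ) x - psi m (W k x)) * χ x
      = (∫ x, u (k * τ) x * χ x) - ∫ x, psi m (W k x) * χ x := fun k hk => by
    simp only [sub_mul]
    exact integral_sub (hu' k hk) (hψ k hk)
  have h1 := hu.step hN hs0 hs1 hΩ hb h𝒯 hT hτ hMT hn hχ
  have h2 := hW.step n hn χ hχ
  have h3 : ∫ x, (psi m (W (n + 1) x) - psi m (W n x)) / τ * χ x
      = τ⁻¹ * ((∫ x, psi m (W (n + 1) x) * χ x) - ∫ x, psi m (W n x) * χ x) := by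
    rw [← integral_sub (hψ _ hn) (hψ _ hn.le), ← integral_const_mul]
    exact integral_congr_ae (ae_of_all _ fun x => by ring)
  have h4 : (∫ x, psi m (W (n + 1) x) * χ x) - (∫ x, psi m (W n x) * χ x)
      + τ * hsForm s (W (n + 1)) χ = 0 := by
    rw [h3] at h2
    have : τ * (τ⁻¹ * ((∫ x, psi m (W (n + 1) x) * χ x) - ∫ x, psi m (W n x) * χ x)
      + hsForm s (W (n + 1)) χ) = 0 := by rw [h2, mul_zero]
    rwa [mul_add, ← mul_assoc, mul_inv_cancel₀ hτ.ne', one_mul] at this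
  have h5 := hsplit n hn.le
  have h6 := hsplit (n + 1) hn
  push_cast at h6
  rw [h5, h6, hsForm_sub_left (integrable_hsDiff_mul (hfe _ hp) (hfe _ hχ))
    (integrable_hsDiff_mul (hfe _ (smul_mem_feSpace τ hWn)) (hfe _ hχ)), hsForm_smul_left,
    hform χ hχ]
  linarith

/-- The energy estimate in real numbers, in terms of the constants of the pointwise estimate and of
the Poincaré inequality. The last term on the left is the energy of the accumulated difference `D`
of the projected exact solution and the discrete one. -/
theorem energy_estimate (hN : 1 ≤ N) (hs0 : 0 < s) (hs1 : s < 1) (hm : 0 < m) (hΩ : IsOpen Ω)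
    (hb : Bornology.IsBounded Ω) (h𝒯 : IsTriangulation Ω κ 𝒯) (hu : IsWeakSolution Ω s m T u₀ u)
    (hT : 0 < T) (hτ : 0 < τ) (hMT : M * τ = T)
    {w : ℝ → EuclideanSpace ℝ (Fin N) → ℝ} (hw : w = fun t x => spow m (u t x))
    (hW : IsDiscreteSolution Ω 𝒯 s m τ M (w 0) W) {c C CP : ℝ} (hc : 0 < c) (hCP : 0 < CP)
    (hpt : ∀ a b p d : ℝ,
      c * quasiIntegrand ((m + 1) / m) a (a - b) ≤ (psi m d - psi m b) * (p - b)
        + C * quasiIntegrand ((m + 1) / m) a (a - p)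
        + C * quasiIntegrand ((m + 1) / m) a (d - a))
    (hP : ∀ v : EuclideanSpace ℝ (Fin N) → ℝ, Measurable v → (∀ x, x ∉ Ω → v x = 0) →
      ∫⁻ x, ENNReal.ofReal (v x ^ 2) ≤ ENNReal.ofReal CP * hsSeminormSq s v)
    (h₂ : ∫⁻ t in Ioo 0 T, quasiNormSq Ω ((m + 1) / m) (w t)
      (fun x => w t x - hsProj Ω 𝒯 s (w t) x) < ∞)
    (h₃ : ∑ n ∈ Finset.Icc 1 M, ∫⁻ t in Ioo (((n : ℝ) - 1) * τ) (n * τ),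
      quasiNormSq Ω ((m + 1) / m) (w t) (fun x => w (n * τ) x - w t x) < ∞)
    (h₀ : eLpNorm (fun x => psi m (w 0 x) - interp Ω 𝒯 (fun y => psi m (w 0 y)) x) 2 volume < ∞) :
    ∃ D ∈ feSpace Ω 𝒯,
      (fun x => (∫ t in Ioo 0 T, w t x) - ∫ t in Ioo 0 T, discreteFun τ W t x) =ᵐ[volume]
        (fun x => τ * ∑ n ∈ Finset.Icc 1 M,
          (timeAvg τ w n x - hsProj Ω 𝒯 s (timeAvg τ w n) x)) + D ∧
      ∫⁻ t in Ioo 0 T, quasiNormSq Ω ((m + 1) / m) (w t)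
        (fun x => w t x - discreteFun τ W t x) < ∞ ∧
      c * (∫⁻ t in Ioo 0 T, quasiNormSq Ω ((m + 1) / m) (w t)
        (fun x => w t x - discreteFun τ W t x)).toReal + 1 / 4 * hsForm s D D
      ≤ CP * (eLpNorm (fun x => psi m (w 0 x) - interp Ω 𝒯 (fun y => psi m (w 0 y)) x) 2
          volume ^ 2).toReal
        + C * (∫⁻ t in Ioo 0 T, quasiNormSq Ω ((m + 1) / m) (w t)
            (fun x => w t x - hsProj Ω 𝒯 s (w t) x)).toReal
        + C * (∑ n ∈ Finset.Icc 1 M, ∫⁻ t in Ioo (((n : ℝ) - 1) * τ) (n * τ),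
            quasiNormSq Ω ((m + 1) / m) (w t) (fun x => w (n * τ) x - w t x)).toReal := by
  obtain ⟨k, b, d, hbfe, hdfe, hproj⟩ := exists_hsProj_eq_sum hN hs0 hs1 hΩ hb h𝒯
  have hfe : ∀ φ ∈ feSpace Ω 𝒯, MemLp (hsDiff s φ) 2 := fun φ hφ =>
    memLp_hsDiff_of_mem_feSpace hN hs0 hs1 hΩ hb h𝒯 hφ
  have hwm : Measurable (Function.uncurry w) := hw ▸ hu.measurable_spow
  have hE : ∫⁻ t in Ioo 0 T, (eLpNorm (w t) 2 volume ^ 2 + hsSeminormSq s (w t)) < ∞ := by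
    rw [hw]; exact hu.energy
  have hψw : ∀ t x, psi m (w t x) = u t x := fun t x => by rw [hw]; exact psi_spow hm _
  set I : ℕ → Set ℝ := fun n => Ioo ((n : ℝ) * τ) ((n + 1) * τ) with hIdef
  have hsub : ∀ n < M, I n ⊆ Ioo 0 T := fun n hn => Ioo_step_subset hτ hMT hn
  have hdecomp : (volume : Measure ℝ).restrict (Ioo 0 T)
      = ∑ n ∈ Finset.range M, volume.restrict (I n) := hMT ▸ restrict_Ioo_eq_sum hτ M
  have hvol : ∀ n, volume.real (I n) = τ := fun n => by
    rw [hIdef, Real.volume_real_Ioo_of_le (by gcongr; linarith)]; ring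
  -- the coordinates of `P_h w(t)`; they describe it for almost every `t` only, since `w(t)` need
  -- not belong to `H^s` for every `t`
  set coeff : Fin k → ℝ → ℝ := fun i t => hsForm s (w t) (b i) with hcoeff
  have hcm : ∀ i, Measurable (coeff i) := fun i => by
    simp only [hcoeff, hsForm_eq]
    exact (((measurable_uncurry_hsDiff hwm).mul ((measurable_hsDiff s (hbfe i).1.measurable).comp
      measurable_snd)).stronglyMeasurable.integral_prod_right').measurable
  have hci : ∀ i, IntegrableOn (coeff i) (Ioo 0 T) := fun i =>
    integrableOn_hsForm hwm hE (hfe _ (hbfe i))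
  have hprojt : ∀ᵐ t ∂volume.restrict (Ioo 0 T), ∀ x,
      hsProj Ω 𝒯 s (w t) x = ∑ i, coeff i t * d i x := by
    filter_upwards [ae_memLp_hsDiff hwm hE] with t ht x
    rw [(hproj (w t) fun χ hχ => integrable_hsDiff_mul ht (hfe χ hχ)).1]
    simp [hcoeff]
  -- the projection of the time integral of `w` over each step
  set V : ℕ → EuclideanSpace ℝ (Fin N) → ℝ := fun n x => ∫ t in I n, w t x with hV
  set p : ℕ → EuclideanSpace ℝ (Fin N) → ℝ := fun n => hsProj Ω 𝒯 s (V n) with hpdef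
  have hVint : ∀ n < M, ∀ χ ∈ feSpace Ω 𝒯,
      (Integrable fun q => hsDiff s (V n) q * hsDiff s χ q) ∧
      hsForm s (V n) χ = ∫ t in I n, hsForm s (w t) χ := fun n hn χ hχ =>
    hsForm_integral hwm hE (hfe χ hχ) (hsub n hn)
  have hpV := fun n (hn : n < M) => hproj (V n) fun χ hχ => (hVint n hn χ hχ).1
  have hpfe : ∀ n < M, p n ∈ feSpace Ω 𝒯 := fun n hn => (hpV n hn).2.1
  have hpform : ∀ n < M, ∀ χ ∈ feSpace Ω 𝒯,
      hsForm s (p n) χ = ∫ t in I n, hsForm s (w t) χ := fun n hn χ hχ =>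
    ((hpV n hn).2.2 χ hχ).trans (hVint n hn χ hχ).2
  have hpsum : ∀ n < M, ∀ x, p n x = ∑ i, (∫ t in I n, coeff i t) * d i x := fun n hn x => by
    simp only [hpdef, (hpV n hn).1, Finset.sum_apply, Pi.smul_apply, smul_eq_mul,
      (hVint n hn _ (hbfe _)).2, hcoeff]
  have hpavg : ∀ n < M, hsProj Ω 𝒯 s (timeAvg τ w (n + 1)) = τ⁻¹ • p n := fun n hn => by
    have hadm : ∀ χ ∈ feSpace Ω 𝒯,
        Integrable fun q => hsDiff s (timeAvg τ w (n + 1)) q * hsDiff s χ q := fun χ hχ => by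
      simp only [timeAvg_succ, hsDiff_smul, Pi.smul_apply, smul_eq_mul, mul_assoc]
      exact (hVint n hn χ hχ).1.const_mul _
    rw [(hproj _ hadm).1, show p n = _ from (hpV n hn).1, Finset.smul_sum]
    refine Finset.sum_congr rfl fun i _ => ?_
    rw [timeAvg_succ, hsForm_smul_left, smul_smul]
  -- the increments of the accumulated error, used as test functions
  have hδex : ∀ n, ∃ δ : feSubmodule Ω 𝒯, n < M → δ.1 = p n - τ • W (n + 1) := fun n => by
    by_cases hn : n < M
    · refine ⟨⟨p n - τ • W (n + 1), ?_⟩, fun _ => rfl⟩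
      exact (feSubmodule Ω 𝒯).sub_mem (hpfe n hn) (smul_mem_feSpace τ (hW.mem n hn))
    · exact ⟨0, fun h => absurd h hn⟩
  choose δ hδ using hδex
  set e : ℕ → feSubmodule Ω 𝒯 → ℝ := fun n χ => ∫ x, (u (n * τ) x - psi m (W n x)) * χ.1 x with he
  have hu0 : ∀ n ≤ M, Integrable (u (n * τ)) := fun n hn => by
    have h1 : (n : ℝ) * τ ≤ M * τ := by gcongr
    exact hu.integrable _ ⟨by positivity, by linarith⟩
  have hg0 : Integrable fun x => u ((0 : ℕ) * τ) x - psi m (W 0 x) :=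
    (hu0 0 (Nat.zero_le _)).sub (hW.integrable_psi hm hb (Nat.zero_le _))
  have henergy := sum_add_half_le (feForm s hfe) (fun x y => hsForm_comm s x.1 y.1)
    (fun x => hsForm_self_nonneg s x.1) e
    (fun φ χ => by
      simp only [he, Submodule.coe_add, Pi.add_apply, mul_add]
      exact integral_add (integrable_mul_of_mem_feSpace hb hg0 φ.2)
        (integrable_mul_of_mem_feSpace hb hg0 χ.2)) δ M
    (fun n hn χ => by
      have := error_equation hN hs0 hs1 hm hΩ hb h𝒯 hu hT hτ hMT hW hn (hpfe n hn)
        (by simpa only [hw] using hpform n hn) χ.2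
      rw [← hδ n hn] at this
      simp only [he]
      push_cast
      exact this)
  set D : feSubmodule Ω 𝒯 := ∑ n ∈ Finset.range M, δ n with hD
  have hDform : feForm s hfe D D = hsForm s D.1 D.1 := rfl
  rw [hDform] at henergy
  have hDx : ∀ x, D.1 x = ∑ n ∈ Finset.range M, (p n x - τ * W (n + 1) x) := fun x => by
    rw [hD, Submodule.coe_sum, Finset.sum_apply]
    exact Finset.sum_congr rfl fun n hn => by rw [hδ n (Finset.mem_range.mp hn)]; rfl
  -- the initial error
  set g₀ : EuclideanSpace ℝ (Fin N) → ℝ :=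
    fun x => psi m (w 0 x) - interp Ω 𝒯 (fun y => psi m (w 0 y)) x with hg₀
  have hg0eq : (fun x => u ((0 : ℕ) * τ) x - psi m (W 0 x)) = g₀ := by
    funext x
    rw [hW.initial, psi_spow hm, hg₀, ← hψw]
    simp
  have hinit : e 0 D ≤ CP * (eLpNorm g₀ 2 volume ^ 2).toReal + 1 / 4 * hsForm s D.1 D.1 := by
    have h1 : e 0 D = ∫ x, g₀ x * D.1 x := by rw [← hg0eq]
    rw [h1]
    exact integral_mul_le_of_poincare hb hCP hP (hg0eq ▸ hg0) h₀ D.2 (hfe _ D.2)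
  -- the quasi-norm terms, split into time steps
  set a₁ : ℕ → ℝ≥0∞ := fun n => ∫⁻ t in I n, quasiNormSq Ω ((m + 1) / m) (w t)
    (fun x => w t x - W (n + 1) x) with ha₁
  set a₂ : ℕ → ℝ≥0∞ := fun n => ∫⁻ t in I n, quasiNormSq Ω ((m + 1) / m) (w t)
    (fun x => w t x - ∑ i, coeff i t * d i x) with ha₂
  set a₃ : ℕ → ℝ≥0∞ := fun n => ∫⁻ t in I n, quasiNormSq Ω ((m + 1) / m) (w t)
    (fun x => w ((n + 1) * τ) x - w t x) with ha₃
  have hsum₁ : ∫⁻ t in Ioo 0 T, quasiNormSq Ω ((m + 1) / m) (w t)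
      (fun x => w t x - discreteFun τ W t x) = ∑ n ∈ Finset.range M, a₁ n := by
    rw [hdecomp, lintegral_finsetSum_measure]
    refine Finset.sum_congr rfl fun n _ => setLIntegral_congr_fun measurableSet_Ioo fun t ht => ?_
    simp only [discreteFun_of_mem hτ W ht]
  have hsum₂ : ∫⁻ t in Ioo 0 T, quasiNormSq Ω ((m + 1) / m) (w t)
      (fun x => w t x - hsProj Ω 𝒯 s (w t) x) = ∑ n ∈ Finset.range M, a₂ n := by
    have : (fun t => quasiNormSq Ω ((m + 1) / m) (w t) (fun x => w t x - hsProj Ω 𝒯 s (w t) x))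
        =ᵐ[volume.restrict (Ioo 0 T)] fun t => quasiNormSq Ω ((m + 1) / m) (w t)
          (fun x => w t x - ∑ i, coeff i t * d i x) := hprojt.mono fun t ht => by simp only [ht]
    rw [lintegral_congr_ae this, hdecomp, lintegral_finsetSum_measure]
  have hsum₃ : ∑ n ∈ Finset.Icc 1 M, ∫⁻ t in Ioo (((n : ℝ) - 1) * τ) (n * τ),
      quasiNormSq Ω ((m + 1) / m) (w t) (fun x => w (n * τ) x - w t x)
      = ∑ n ∈ Finset.range M, a₃ n := by
    rw [sum_Icc_one_eq_sum_range]
    refine Finset.sum_congr rfl fun n _ => ?_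
    simp only [ha₃, hIdef]
    push_cast
    rw [add_sub_cancel_right]
  rw [hsum₂] at h₂ ⊢
  rw [hsum₃] at h₃ ⊢
  rw [hsum₁]
  have h₂' : ∀ n ∈ Finset.range M, a₂ n < ∞ := ENNReal.sum_lt_top.mp h₂
  have h₃' : ∀ n ∈ Finset.range M, a₃ n < ∞ := ENNReal.sum_lt_top.mp h₃
  have hstep : ∀ n ∈ Finset.range M, a₁ n < ∞ ∧
      c * (a₁ n).toReal ≤ e (n + 1) (δ n) + C * (a₂ n).toReal + C * (a₃ n).toReal := by
    intro n hn
    have hnM := Finset.mem_range.mp hn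
    have hu1 := hu0 (n + 1) hnM
    push_cast at hu1
    have h := mul_toReal_lintegral_quasiNormSq_le (𝒯 := 𝒯) hb hm hc hpt (I := I n)
      measure_Ioo_lt_top hcm (fun i => (hci i).mono_set (hsub n hnM)) hdfe hwm
      (d₀ := w ((n + 1) * τ)) hwm.of_uncurry_left (by simpa only [hψw] using hu1) (hW.mem n hnM)
      (h₂' n hn) (h₃' n hn)
    refine ⟨h.1, h.2.trans_eq ?_⟩
    congr 2
    simp only [he, hvol, hψw]
    push_cast
    refine integral_congr_ae (ae_of_all _ fun x => ?_)
    simp only [hδ n hnM, Pi.sub_apply, Pi.smul_apply, smul_eq_mul, hpsum n hnM x]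
  refine ⟨D.1, D.2, ?_, ENNReal.sum_lt_top.mpr fun n hn => (hstep n hn).1, ?_⟩
  · filter_upwards [ae_integrableOn_time hwm hE] with x hx
    have hWi : ∀ n, ∀ t ∈ I n, discreteFun τ W t x = W (n + 1) x := fun n t ht => by
      rw [discreteFun_of_mem hτ W ht]
    have hWint : ∀ n, IntegrableOn (fun t => discreteFun τ W t x) (I n) := fun n =>
      (integrableOn_const (by exact measure_Ioo_lt_top.ne)).congr_fun
        (fun t ht => (hWi n t ht).symm) measurableSet_Ioo
    rw [hdecomp,
      integral_finsetSum_measure fun n hn => hx.mono_set (hsub n (Finset.mem_range.mp hn)),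
      integral_finsetSum_measure fun n _ => hWint n, Pi.add_apply, hDx,
      sum_Icc_one_eq_sum_range, Finset.mul_sum, ← Finset.sum_sub_distrib, ← Finset.sum_add_distrib]
    refine Finset.sum_congr rfl fun n hn => ?_
    rw [hpavg n (Finset.mem_range.mp hn), timeAvg_succ,
      setIntegral_congr_fun measurableSet_Ioo (hWi n), setIntegral_const, hvol]
    simp only [Pi.smul_apply, smul_eq_mul]
    rw [mul_sub, ← mul_assoc, ← mul_assoc, mul_inv_cancel₀ hτ.ne']
    ring
  · rw [ENNReal.toReal_sum fun n hn => ((hstep n hn).1).ne,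
      ENNReal.toReal_sum fun n hn => (h₂' n hn).ne, ENNReal.toReal_sum fun n hn => (h₃' n hn).ne]
    have hle := Finset.sum_le_sum fun n hn => (hstep n hn).2
    rw [Finset.sum_add_distrib, Finset.sum_add_distrib, ← Finset.mul_sum, ← Finset.mul_sum,
      ← Finset.mul_sum] at hle
    linarith

end

end FracDiffusion

open FracDiffusion

/-! ### The error estimate -/

theorem theorem3p1 (N : ℕ) (hN : 1 ≤ N) (Ω : Set (EuclideanSpace ℝ (Fin N)))
    (hΩ : IsConvexPolyhedralDomain Ω) (s : ℝ) (hs0 : 0 < s) (hs1 : s < 1) (m : ℝ) (hm : 0 < m)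
    (κ : ℝ) (hκ : 0 < κ) :
    ∃ c : ℝ, 0 < c ∧
      ∀ (T : ℝ), 0 < T →
      ∀ (u₀ : EuclideanSpace ℝ (Fin N) → ℝ), MemLp u₀ ∞ volume → (∀ x, x ∉ Ω → u₀ x = 0) →
      ∀ (u : ℝ → EuclideanSpace ℝ (Fin N) → ℝ), IsWeakSolution Ω s m T u₀ u →
      ∀ (w : ℝ → EuclideanSpace ℝ (Fin N) → ℝ), (w = fun t x => spow m (u t x)) →
      ∀ (𝒯 : Geometry.SimplicialComplex ℝ (EuclideanSpace ℝ (Fin N))), IsTriangulation Ω κ 𝒯 →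
      ∀ (τ : ℝ) (M : ℕ), 0 < τ → M * τ = T →
      ∀ (W : ℕ → EuclideanSpace ℝ (Fin N) → ℝ), IsDiscreteSolution Ω 𝒯 s m τ M (w 0) W →
        (∫⁻ t in Ioo 0 T,
            quasiNormSq Ω ((m + 1) / m) (w t) (fun x => w t x - discreteFun τ W t x))
          + hsSeminormSq s (fun x =>
              (∫ t in Ioo 0 T, w t x) - ∫ t in Ioo 0 T, discreteFun τ W t x)
        ≤ ENNReal.ofReal c *
          ((∑ n ∈ Finset.Icc 1 M, ∫⁻ t in Ioo (((n : ℝ) - 1) * τ) (n * τ),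
              quasiNormSq Ω ((m + 1) / m) (w t) (fun x => w (n * τ) x - w t x))
            + (∫⁻ t in Ioo 0 T,
                quasiNormSq Ω ((m + 1) / m) (w t) (fun x => w t x - hsProj Ω 𝒯 s (w t) x))
            + eLpNorm (fun x => psi m (w 0 x) - interp Ω 𝒯 (fun y => psi m (w 0 y)) x) 2
                volume ^ 2
            + hsSeminormSq s (fun x => τ * ∑ n ∈ Finset.Icc 1 M,
                (timeAvg τ w n x - hsProj Ω 𝒯 s (timeAvg τ w n) x))) := by
  obtain ⟨c, C, hc, hC, hpt⟩ := exists_quasiIntegrand_le hm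
  obtain ⟨CP, hCP, hP⟩ := exists_poincare hN hs0 hΩ.isBounded
  set K : ℝ := (c⁻¹ + 8) * (C + CP) + 2
  have hK : 0 < K := by positivity
  refine ⟨K, hK, ?_⟩
  intro T hT u₀ _ _ u hu w hw 𝒯 h𝒯 τ M hτ hMT W hW
  set R₁ := ∑ n ∈ Finset.Icc 1 M, ∫⁻ t in Ioo (((n : ℝ) - 1) * τ) (n * τ),
    quasiNormSq Ω ((m + 1) / m) (w t) (fun x => w (n * τ) x - w t x) with hR₁
  set R₂ := ∫⁻ t in Ioo 0 T,
    quasiNormSq Ω ((m + 1) / m) (w t) (fun x => w t x - hsProj Ω 𝒯 s (w t) x) with hR₂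
  set R₃ := eLpNorm (fun x => psi m (w 0 x) - interp Ω 𝒯 (fun y => psi m (w 0 y)) x) 2
    volume ^ 2 with hR₃
  set R₄ := hsSeminormSq s (fun x => τ * ∑ n ∈ Finset.Icc 1 M,
    (timeAvg τ w n x - hsProj Ω 𝒯 s (timeAvg τ w n) x)) with hR₄
  -- if one of the first three terms is infinite, so is the right side, since `K > 0`
  by_cases hfin : R₁ + R₂ + R₃ = ∞
  · rw [hfin, top_add, ENNReal.mul_top (ENNReal.ofReal_pos.mpr hK).ne']
    exact le_top
  have h12 : R₁ + R₂ ≠ ∞ := fun h => hfin (by rw [h, top_add])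
  have h1 : R₁ ≠ ∞ := fun h => h12 (by rw [h, top_add])
  have h2 : R₂ ≠ ∞ := fun h => h12 (by rw [h, add_top])
  have h3 : R₃ ≠ ∞ := fun h => hfin (by rw [h, add_top])
  have h3' : eLpNorm (fun x => psi m (w 0 x) - interp Ω 𝒯 (fun y => psi m (w 0 y)) x) 2
      volume < ∞ := by
    refine lt_top_iff_ne_top.mpr fun h => h3 ?_
    rw [hR₃, h]; simp
  obtain ⟨D, hD, hae, hfin₁, hest⟩ := energy_estimate hN hs0 hs1 hm hΩ.isOpen hΩ.isBounded h𝒯 hu hT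
    hτ hMT hw hW hc hCP hpt hP (lt_top_iff_ne_top.mpr h2) (lt_top_iff_ne_top.mpr h1) h3'
  rw [← hR₁, ← hR₂, ← hR₃] at hest
  set A := ∫⁻ t in Ioo 0 T,
    quasiNormSq Ω ((m + 1) / m) (w t) (fun x => w t x - discreteFun τ W t x)
  have hDs : MemLp (hsDiff s D) 2 :=
    memLp_hsDiff_of_mem_feSpace hN hs0 hs1 hΩ.isOpen hΩ.isBounded h𝒯 hD
  have hD0 := hsForm_self_nonneg s D
  set r₁ := R₁.toReal
  set r₂ := R₂.toReal
  set r₃ := R₃.toReal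
  have hr₁ : 0 ≤ r₁ := ENNReal.toReal_nonneg
  have hr₂ : 0 ≤ r₂ := ENNReal.toReal_nonneg
  have hr₃ : 0 ≤ r₃ := ENNReal.toReal_nonneg
  have hA0 : 0 ≤ A.toReal := ENNReal.toReal_nonneg
  have hX : c * A.toReal + 1 / 4 * hsForm s D D ≤ (C + CP) * (r₁ + r₂ + r₃) := by nlinarith
  have hreal : A.toReal + 2 * hsForm s D D ≤ K * (r₁ + r₂ + r₃) := by
    have e1 : A.toReal ≤ c⁻¹ * ((C + CP) * (r₁ + r₂ + r₃)) := by
      rw [inv_mul_eq_div, le_div_iff₀ hc]; linarith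
    have e2 : 2 * hsForm s D D ≤ 8 * ((C + CP) * (r₁ + r₂ + r₃)) := by
      have : 0 ≤ c * A.toReal := by positivity
      linarith
    calc _ ≤ (c⁻¹ + 8) * (C + CP) * (r₁ + r₂ + r₃) := by linarith
      _ ≤ _ := by gcongr; simp only [K]; linarith
  have hsem : hsSeminormSq s (fun x =>
      (∫ t in Ioo 0 T, w t x) - ∫ t in Ioo 0 T, discreteFun τ W t x)
      ≤ 2 * R₄ + ENNReal.ofReal (2 * hsForm s D D) := by
    rw [hsSeminormSq_congr_ae s hae, ENNReal.ofReal_mul two_pos.le, ofReal_hsForm_self hDs,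
      ENNReal.ofReal_ofNat]
    exact hsSeminormSq_add_le s _ hD.1.measurable
  calc _ ≤ A + (2 * R₄ + ENNReal.ofReal (2 * hsForm s D D)) := by gcongr
    _ = ENNReal.ofReal (A.toReal + 2 * hsForm s D D) + 2 * R₄ := by
      rw [ENNReal.ofReal_add hA0 (by positivity), ENNReal.ofReal_toReal hfin₁.ne]
      ring
    _ ≤ ENNReal.ofReal (K * (r₁ + r₂ + r₃)) + ENNReal.ofReal K * R₄ := by
      gcongr
      rw [← ENNReal.ofReal_ofNat]
      refine ENNReal.ofReal_le_ofReal ?_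
      have : 0 ≤ (c⁻¹ + 8) * (C + CP) := by positivity
      simp only [K]
      linarith
    _ = ENNReal.ofReal K * (R₁ + R₂ + R₃ + R₄) := by
      rw [ENNReal.ofReal_mul hK.le, ENNReal.ofReal_add (by positivity) hr₃,
        ENNReal.ofReal_add hr₁ hr₂, ENNReal.ofReal_toReal h1, ENNReal.ofReal_toReal h2,
        ENNReal.ofReal_toReal h3, mul_add _ _ R₄]
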